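/- Let $m\ge 1$, $n=m+1$, and consider $n$ spatially separated parties: Alice, with Hilbert space $\mathbb{C}^{n+1}=\mathbb{C}^{m+2}$ and orthonormal basis $|p\rangle,|q\rangle,|1\rangle,\dots,|m\rangle$, and Bob-$i$ ($1\le i\le m$), with Hilbert space $\mathbb{C}^3$ and orthonormal basis $|p\rangle,|q\rangle,|i\rangle$. Put $|\epsilon_\pm\rangle=\frac1{\sqrt2}(|p\rangle\pm|q\rangle)$ and $|\gamma^i_\pm\rangle=\frac1{\sqrt2}(|q\rangle\pm|i\rangle)$. Let $\mathbb{G}_n\subset\mathbb{C}^{n+1}\otimes(\mathbb{C}^3)^{\otimes(n-1)}$ be the set of the $2(3m+1)$ product states $$|\zeta^0_\pm\rangle=|\epsilon_\pm\rangle_A\otimes\bigotimes_{k}|k\rangle_{B_k},\qquad |\zeta^{i,1}_\pm\rangle=|i\rangle_A|\gamma^i_\pm\rangle_{B_i}\otimes\bigotimes_{k\ne i}|k\rangle_{B_k},$$ $$|\zeta^{i,2}_\pm\rangle=|\gamma^i_\pm\rangle_A|p\rangle_{B_i}\otimes\bigotimes_{k\ne i}|k\rangle_{B_k},\qquad |\zeta^{i,3}_\pm\rangle=|p\rangle_A|\epsilon_\pm\rangle_{B_i}\otimes\bigotimes_{k\ne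 i}|k\rangle_{B_k}\qquad(1\le i\le m).$$ Fix prior probabilities $p_\zeta>0$, $\sum_{\zeta\in\mathbb{G}_n}p_\zeta=1$ (for instance uniform ones). In the task $\tau_n$ a single copy of a state $|\zeta\rangle$, drawn from $\mathbb{G}_n$ with probability $p_\zeta$, is distributed among the parties, who have to identify it by local operations and classical communication (LOCC), possibly assisted by a shared resource state $x$. The payoff $\mathcal{P}_{\tau_n}(x)$ is the supremum, over all finite-round LOCC protocols acting on $|\zeta\rangle\langle\zeta|\otimes x$, of the probability of a correct identification, and $x\succ_{\tau_n}y$ means $\mathcal{P}_{\tau_n}(x)>\mathcal{P}_{\tau_n}(y)$. Then $|g_n\rangle\succ_{\tau_n}\rho$, where $|g_n\rangle=\frac1{\sqrt2}(|0\rangle^{\otimes n}+|1\rangle^{\otimes n})$ is the $n$-qubit GHZ state with one qubit held by each party, and $\rho$ is any density operator on $\bigotimes_{j=1}^{n-1}\mathbb{C}^{d_j}$ with arbitrary local dimensions $d_j$, whose $n-1$ subsystems are distributed in an arbitrary way among the $n$ parties (in particular, one each to any $n-1$ of them). -/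

import Mathlib

open scoped Matrix BigOperators ComplexOrder

noncomputable section

/-! ### Quantum states -/

/-- Density operators on the finite-dimensional Hilbert space with orthonormal basis `S`. -/
def IsDensity {S : Type} [Fintype S] (ρ : Matrix S S ℂ) : Prop :=
  ρ.PosSemidef ∧ ρ.trace = 1

/-- The rank-one operator `|v⟩⟨v|`. -/
def pureState {S : Type} (v : S → ℂ) : Matrix S S ℂ :=
  Matrix.vecMulVec v (star v)

/-! ### LOCC protocols

The party `i` of a finite set `ι` of parties holds a Hilbert space with orthonormal basis `H i`;
the joint Hilbert space has the product basis `∀ i, H i`. -/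

/-- The tensor product of the local operators `K i`. -/
def tensorOp {ι : Type} [Fintype ι] {H H' : ι → Type}
    (K : ∀ i, Matrix (H' i) (H i) ℂ) : Matrix (∀ i, H' i) (∀ i, H i) ℂ :=
  Matrix.of fun x y => ∏ i, K i (x i) (y i)

/-- Finite-round LOCC protocols that end with the announcement of an element of `X`.
In a round every party `i` performs a local measurement with Kraus operators `K i a`, where
`a` runs over `Fin (k i)`, from its current space to a space of some dimension `e i` (ancillas can
be added or discarded); all outcomes are broadcast, and the rest of the protocol may depend on
them. A party is idle in a round if it has the identity as its only Kraus operator. -/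
inductive LOCC (ι : Type) (X : Type) :
    (H : ι → Type) → [∀ i, Fintype (H i)] → [∀ i, DecidableEq (H i)] → Type 1
  | guess {H : ι → Type} [∀ i, Fintype (H i)] [∀ i, DecidableEq (H i)] (x : X) : LOCC ι X H
  | round {H : ι → Type} [∀ i, Fintype (H i)] [∀ i, DecidableEq (H i)]
      (k e : ι → ℕ)
      (K : ∀ i, Fin (k i) → Matrix (Fin (e i)) (H i) ℂ)
      (hK : ∀ i, ∑ a, (K i a)ᴴ * K i a = 1)
      (next : (∀ i, Fin (k i)) → LOCC ι X (fun i => Fin (e i))) : LOCC ι X H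

/-- The probability that the protocol, run on the (possibly subnormalized) state `σ`, ends with
the announcement of `x`. -/
def LOCC.prob {ι X : Type} [Fintype ι] [DecidableEq ι] [DecidableEq X] :
    {H : ι → Type} → [∀ i, Fintype (H i)] → [∀ i, DecidableEq (H i)] →
      LOCC ι X H → Matrix (∀ i, H i) (∀ i, H i) ℂ → X → ℝ
  | _, _, _, LOCC.guess y, σ, x => if y = x then σ.trace.re else 0
  | _, _, _, LOCC.round k _ K _ next, σ, x =>
      ∑ a : (∀ i, Fin (k i)),
        LOCC.prob (next a)
          (tensorOp (fun i => K i (a i)) * σ * (tensorOp (fun i => K i (a i)))ᴴ) x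

/-! ### Local state discrimination with a shared resource state -/

/-- Basis of the space of party `j`: its share, of dimension `D j`, of the state to be identified,
and those subsystems `s` of the resource state, of dimension `d s`, whose holder `own s` is `j`. -/
abbrev PartySpace {ι S : Type} (D : ι → ℕ) (own : S → ι) (d : S → ℕ) (j : ι) : Type :=
  Fin (D j) × (∀ s : {s : S // own s = j}, Fin (d s))

/-- The joint state `|ψ⟩⟨ψ| ⊗ ρ`, with its tensor factors arranged party by party. -/
def jointState {ι S : Type} {D : ι → ℕ} {d : S → ℕ} (ψ : (∀ j, Fin (D j)) → ℂ)
    (own : S → ι) (ρ : Matrix (∀ s, Fin (d s)) (∀ s, Fin (d s)) ℂ) :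
    Matrix (∀ j, PartySpace D own d j) (∀ j, PartySpace D own d j) ℂ :=
  Matrix.of fun x y =>
    pureState ψ (fun j => (x j).1) (fun j => (y j).1) *
      ρ (fun s => (x (own s)).2 ⟨s, rfl⟩) (fun s => (y (own s)).2 ⟨s, rfl⟩)

/-- The payoff of the task of identifying by LOCC a state drawn from the ensemble `{p x, ψ x}`, one
copy being given, with the resource state `ρ` whose subsystem `s` is held by the party `own s`:
the supremum over all LOCC protocols of the probability of a correct identification. -/
def payoff {ι S X : Type} [Fintype ι] [DecidableEq ι] [Fintype S] [DecidableEq S]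
    [Fintype X] [DecidableEq X]
    {D : ι → ℕ} {d : S → ℕ} (p : X → ℝ) (ψ : X → (∀ j, Fin (D j)) → ℂ)
    (own : S → ι) (ρ : Matrix (∀ s, Fin (d s)) (∀ s, Fin (d s)) ℂ) : ℝ :=
  ⨆ P : LOCC ι X (PartySpace D own d), ∑ x, p x * P.prob (jointState (ψ x) own ρ) x

/-! ### The GHZ state -/

/-- The `n`-qubit state `(|0…0⟩ + |1…1⟩)/√2`. -/
def ghz (n : ℕ) : (Fin n → Fin 2) → ℂ := fun y =>
  ((Real.sqrt 2 : ℝ) : ℂ)⁻¹ *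
    ((if ∀ j, y j = 0 then 1 else 0) + (if ∀ j, y j = 1 then 1 else 0))

/-! ### The set of product states

There are `m + 1` parties: Alice is party `0` and Bob-`i` is party `i.succ`. Alice has the basis
`|p⟩, |q⟩, |1⟩, …, |m⟩`, in this order, and Bob-`i` the basis `|p⟩, |q⟩, |i⟩`. Bobs are numbered
from `0` here, so that `|i⟩` is Alice's basis vector number `i + 2`. -/

/-- The local dimensions `m + 2, 3, …, 3`. -/
def gDim (m : ℕ) : Fin (m + 1) → ℕ := Fin.cases (m + 2) (fun _ => 3)

/-- The basis vector number `a` of `ℂ ^ D`. -/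
def ket (D a : ℕ) : Fin D → ℂ := fun x => if x.val = a then 1 else 0

/-- `(|a⟩ ± |b⟩)/√2`, with the sign `+` for `true`. -/
def ketPM (D a b : ℕ) (s : Bool) : Fin D → ℂ := fun x =>
  ((Real.sqrt 2 : ℝ) : ℂ)⁻¹ * (ket D a x + (if s then 1 else -1) * ket D b x)

/-- The names `0`, `(i,1)`, `(i,2)`, `(i,3)` of the pairs of states. -/
inductive GLabel (m : ℕ) : Type
  | zero : GLabel m
  | one (i : Fin m) : GLabel m
  | two (i : Fin m) : GLabel m
  | three (i : Fin m) : GLabel m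
  deriving DecidableEq, Fintype

/-- The local state of party `j` in the product state with the given name and sign. -/
def gLocal (m : ℕ) (l : GLabel m) (s : Bool) (j : Fin (m + 1)) : Fin (gDim m j) → ℂ :=
  match l with
  | .zero => Fin.cases (motive := fun j => Fin (gDim m j) → ℂ)
      (ketPM (m + 2) 0 1 s) (fun _ => ket 3 2) j
  | .one i => Fin.cases (motive := fun j => Fin (gDim m j) → ℂ)
      (ket (m + 2) (i.val + 2)) (fun k => if k = i then ketPM 3 1 2 s else ket 3 2) j
  | .two i => Fin.cases (motive := fun j => Fin (gDim m j) → ℂ)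
      (ketPM (m + 2) 1 (i.val + 2) s) (fun k => if k = i then ket 3 0 else ket 3 2) j
  | .three i => Fin.cases (motive := fun j => Fin (gDim m j) → ℂ)
      (ket (m + 2) 0) (fun k => if k = i then ketPM 3 0 1 s else ket 3 2) j

/-- The product states of the set, indexed by name and sign. -/
def gState (m : ℕ) (x : GLabel m × Bool) : (∀ j, Fin (gDim m j)) → ℂ :=
  fun y => ∏ j, gLocal m x.1 x.2 j (y j)

end

/-! ### Tensor products of local operators -/

section TensorOp

variable {ι : Type} [Fintype ι] {H H' H'' : ι → Type}

/-! Since `n - 1` subsystems cannot reach all `n` parties, some party `j` holds no share of `ρ`. The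
payoff with `ρ` is then strictly below 1, while with the GHZ state it is at least 1.

Upper bound. Writing `ρ = C * Cᴴ` turns joint states into matrices `W`, on which Kraus operators act
from the left and whose squared Frobenius norms are probabilities. Across the cut `j` against the
rest, four of the pairs are domino states built from three local vectors on each side, and every
LOCC branch preserves this product form. Two bounds on the total error are combined. A final
announcement misses at least one member of each pair, so unequal norms of the two superposed terms
cost the error `overlapDefect`; by Cauchy–Schwarz this quantity does not decrease on summing over
the outcomes of a measurement, so it bounds the error from any node on
(`overlapDefect_le_dominoError`). Initially it vanishes. If the norms on one side become unbalanced
while the other side is still balanced, it is at least a fixed fraction of the weight of the branch;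
if a branch stays balanced to the end, some pair is missed entirely and both its states still have
comparable norm. Either way a fixed fraction of the weight is lost (`NormBalanced.le_dominoError`),
which bounds the supremum away from 1 (`payoff_lt_one`).

Perfect protocol. By comparing her qubit with the question whether her vector lies in the span of
`p` and `q`, Alice makes every GHZ qubit carry the answer coherently. Each Bob can then test for
`(i,2)` and `(i,3)` without separating the two terms of any state, and a last measurement by Alice
completes the name. The sign is the eigenvalue of a product of local involutions exchanging the two
terms, read off by measuring each factor (`perfectlyDistinguishable_ghzState`). -/

theorem tensorOp_mul [DecidableEq ι] [∀ i, Fintype (H' i)] (K : ∀ i, Matrix (H'' i) (H' i) ℂ)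
    (L : ∀ i, Matrix (H' i) (H i) ℂ) :
    tensorOp K * tensorOp L = tensorOp fun i => K i * L i := by
  ext x y
  simp only [tensorOp, Matrix.mul_apply, Matrix.of_apply, ← Finset.prod_mul_distrib]
  rw [Finset.prod_univ_sum, Fintype.piFinset_univ]

theorem tensorOp_conjTranspose (K : ∀ i, Matrix (H' i) (H i) ℂ) :
    (tensorOp K)ᴴ = tensorOp fun i => (K i)ᴴ := by
  ext x y
  simp [tensorOp, Matrix.conjTranspose_apply]

theorem tensorOp_one [∀ i, DecidableEq (H i)] :
    tensorOp (fun i => (1 : Matrix (H i) (H i) ℂ)) = 1 := by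
  ext x y
  simp only [tensorOp, Matrix.of_apply, Matrix.one_apply]
  by_cases h : x = y
  · simp [h]
  · obtain ⟨i, hi⟩ := Function.ne_iff.1 h
    rw [if_neg h]
    exact Finset.prod_eq_zero (Finset.mem_univ i) (if_neg hi)

theorem sum_tensorOp [DecidableEq ι] {k : ι → ℕ} (M : ∀ i, Fin (k i) → Matrix (H' i) (H i) ℂ) :
    ∑ a : (∀ i, Fin (k i)), tensorOp (fun i => M i (a i)) = tensorOp fun i => ∑ a, M i a := by
  ext x y
  simp only [tensorOp, Matrix.of_apply, Matrix.sum_apply]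
  rw [Finset.prod_univ_sum, Fintype.piFinset_univ]

theorem tensorOp_complete [DecidableEq ι] [∀ i, Fintype (H' i)] [∀ i, DecidableEq (H i)] {k : ι → ℕ}
    (K : ∀ i, Fin (k i) → Matrix (H' i) (H i) ℂ) (hK : ∀ i, ∑ a, (K i a)ᴴ * K i a = 1) :
    ∑ a : (∀ i, Fin (k i)),
      (tensorOp fun i => K i (a i))ᴴ * (tensorOp fun i => K i (a i)) = 1 := by
  simp only [tensorOp_conjTranspose, tensorOp_mul]
  rw [sum_tensorOp (fun i a => (K i a)ᴴ * K i a)]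
  simp only [hK, tensorOp_one]

end TensorOp

/-! ### The Frobenius norm -/

/-- A matrix as a vector of a Euclidean space. -/
noncomputable def frobVec {A κ : Type} (W : Matrix A κ ℂ) : EuclideanSpace ℂ (A × κ) :=
  WithLp.toLp 2 fun q => W q.1 q.2

theorem frobVec_comb {A κ : Type} (P Q : Matrix A κ ℂ) (c z : ℂ) :
    frobVec (c • (P + z • Q)) = c • (frobVec P + z • frobVec Q) := by
  ext q; simp [frobVec, mul_add]

/-- The matrices `(P ± Q)/√2`. -/
noncomputable def pmComb {A κ : Type} (P Q : Matrix A κ ℂ) (s : Bool) : Matrix A κ ℂ :=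
  ((Real.sqrt 2 : ℝ) : ℂ)⁻¹ • (P + (if s then (1 : ℂ) else -1) • Q)

theorem mul_pmComb {A B κ : Type} [Fintype A] (T : Matrix B A ℂ) (P Q : Matrix A κ ℂ) (s : Bool) :
    T * pmComb P Q s = pmComb (T * P) (T * Q) s := by
  rw [pmComb, pmComb, Matrix.mul_smul, Matrix.mul_add, Matrix.mul_smul]

section Frobenius

variable {A B κ : Type} [Fintype A] [Fintype B] [Fintype κ]

/-- The Frobenius norm. -/
noncomputable def frob (W : Matrix A κ ℂ) : ℝ := ‖frobVec W‖

theorem frob_nonneg (W : Matrix A κ ℂ) : 0 ≤ frob W := norm_nonneg _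

theorem frob_sq (W : Matrix A κ ℂ) : frob W ^ 2 = ∑ a, ∑ k, ‖W a k‖ ^ 2 := by
  rw [frob, EuclideanSpace.norm_sq_eq, Fintype.sum_prod_type]
  rfl

theorem frob_sq_eq_trace (W : Matrix A κ ℂ) : frob W ^ 2 = (W * Wᴴ).trace.re := by
  rw [frob_sq, Matrix.trace, Complex.re_sum]
  refine Finset.sum_congr rfl fun a _ => ?_
  rw [Matrix.diag_apply, Matrix.mul_apply, Complex.re_sum]
  refine Finset.sum_congr rfl fun k _ => ?_
  rw [Matrix.conjTranspose_apply, Complex.star_def, Complex.mul_conj, Complex.ofReal_re,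
    Complex.normSq_eq_norm_sq]

theorem frob_sq_eq_trace' (W : Matrix A κ ℂ) : frob W ^ 2 = (Wᴴ * W).trace.re := by
  rw [frob_sq_eq_trace, Matrix.trace_mul_comm]

/-- A complete family of Kraus operators preserves the total squared norm. -/
theorem sum_frob_sq_mul [DecidableEq A] {O : Type} [Fintype O] (T : O → Matrix B A ℂ)
    (hT : ∑ a, (T a)ᴴ * T a = 1) (W : Matrix A κ ℂ) :
    ∑ a, frob (T a * W) ^ 2 = frob W ^ 2 := by
  have h : ∀ a, frob (T a * W) ^ 2 = (Wᴴ * ((T a)ᴴ * T a) * W).trace.re := fun a => by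
    rw [frob_sq_eq_trace', Matrix.conjTranspose_mul]
    simp only [Matrix.mul_assoc]
  simp only [h]
  rw [← Complex.re_sum, ← Matrix.trace_sum, ← Matrix.sum_mul, ← Matrix.mul_sum, hT, Matrix.mul_one,
    frob_sq_eq_trace']

theorem norm_inv_sqrt_two_sq : ‖((Real.sqrt 2 : ℝ) : ℂ)⁻¹‖ ^ 2 = 1 / 2 := by
  rw [norm_inv, Complex.norm_real, Real.norm_of_nonneg (Real.sqrt_nonneg 2), inv_pow,
    Real.sq_sqrt (by norm_num)]
  norm_num

theorem frob_pmComb_sq (P Q : Matrix A κ ℂ) (s : Bool) :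
    frob (pmComb P Q s) ^ 2
      = 1 / 2 * ‖frobVec P + (if s then (1 : ℂ) else -1) • frobVec Q‖ ^ 2 := by
  rw [frob, pmComb, frobVec_comb, norm_smul, mul_pow, norm_inv_sqrt_two_sq]

/-- Reverse triangle inequality. It holds for each sign separately, so the loss occurs whichever
member of a pair is missed. -/
theorem le_frob_pmComb_sq (P Q : Matrix A κ ℂ) (s : Bool) :
    1 / 2 * (frob P - frob Q) ^ 2 ≤ frob (pmComb P Q s) ^ 2 := by
  rw [frob_pmComb_sq]
  have h := abs_norm_sub_norm_le (frobVec P) (-((if s then (1 : ℂ) else -1) • frobVec Q))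
  have hn : ‖-((if s then (1 : ℂ) else -1) • frobVec Q)‖ = frob Q := by
    cases s <;> simp [frob]
  rw [hn, sub_neg_eq_add] at h
  have h2 := pow_le_pow_left₀ (abs_nonneg _) h 2
  rw [sq_abs] at h2
  have h3 : frob P = ‖frobVec P‖ := rfl
  rw [h3]
  linarith

theorem frob_pmComb_sq_add (P Q : Matrix A κ ℂ) :
    frob (pmComb P Q true) ^ 2 + frob (pmComb P Q false) ^ 2 = frob P ^ 2 + frob Q ^ 2 := by
  rw [frob_pmComb_sq, frob_pmComb_sq]
  have h := parallelogram_law_with_norm ℂ (frobVec P) (frobVec Q)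
  simp only [if_true, Bool.false_eq_true, if_false, one_smul, neg_smul, ← sub_eq_add_neg]
  simp only [frob]
  nlinarith

end Frobenius

/-! ### Probabilities of protocols on states `W * Wᴴ` -/

section Prob

variable {ι X κ : Type} [Fintype ι] [DecidableEq ι] [DecidableEq X] [Fintype κ]
  {H : ι → Type} [∀ i, Fintype (H i)] [∀ i, DecidableEq (H i)]

theorem LOCC.prob_guess (y : X) (W : Matrix (∀ i, H i) κ ℂ) (x : X) :
    (LOCC.guess (ι := ι) (H := H) y).prob (W * Wᴴ) x = if y = x then frob W ^ 2 else 0 := by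
  rw [LOCC.prob, frob_sq_eq_trace]

theorem LOCC.prob_round (k e : ι → ℕ) (K : ∀ i, Fin (k i) → Matrix (Fin (e i)) (H i) ℂ)
    (hK : ∀ i, ∑ a, (K i a)ᴴ * K i a = 1)
    (next : (∀ i, Fin (k i)) → LOCC ι X (fun i => Fin (e i))) (W : Matrix (∀ i, H i) κ ℂ) (x : X) :
    (LOCC.round k e K hK next).prob (W * Wᴴ) x = ∑ a : (∀ i, Fin (k i)),
      (next a).prob (((tensorOp fun i => K i (a i)) * W) * ((tensorOp fun i => K i (a i)) * W)ᴴ)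
        x := by
  rw [LOCC.prob]
  simp only [Matrix.conjTranspose_mul, Matrix.mul_assoc]

theorem sum_frob_sq_tensorOp_mul {H' : ι → Type} [∀ i, Fintype (H' i)] {k : ι → ℕ}
    (K : ∀ i, Fin (k i) → Matrix (H' i) (H i) ℂ) (hK : ∀ i, ∑ a, (K i a)ᴴ * K i a = 1)
    (W : Matrix (∀ i, H i) κ ℂ) :
    ∑ a : (∀ i, Fin (k i)), frob ((tensorOp fun i => K i (a i)) * W) ^ 2 = frob W ^ 2 :=
  sum_frob_sq_mul (fun a : (∀ i, Fin (k i)) => tensorOp fun i => K i (a i))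
    (tensorOp_complete K hK) W

theorem LOCC.prob_le (P : LOCC ι X H) (W : Matrix (∀ i, H i) κ ℂ) (x : X) :
    P.prob (W * Wᴴ) x ≤ frob W ^ 2 := by
  induction P with
  | guess y =>
    rw [LOCC.prob_guess]
    split_ifs
    · exact le_rfl
    · positivity
  | round k e K hK next ih =>
    rw [LOCC.prob_round, ← sum_frob_sq_tensorOp_mul K hK W]
    exact Finset.sum_le_sum fun a _ => ih a _

end Prob

/-! ### One party against the others -/

section Bipartition

variable {ι κ : Type} [Fintype ι] [DecidableEq ι] {H H' : ι → Type}

/-- The tensor product of a vector `β` of the party `j` with a matrix `V` whose rows belong to the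
other parties. -/
def loneTensor (j : ι) (V : Matrix (∀ i : {i // i ≠ j}, H i) κ ℂ) (β : Matrix (H j) Unit ℂ) :
    Matrix (∀ i, H i) κ ℂ :=
  Matrix.of fun x k => V (fun i => x i) k * β (x j) ()

/-- Used both for basis indices and for measurement outcomes: a simultaneous round can be read as
the others measuring first and `j` second. -/
theorem sum_pi_eq_sum_sum_ne {M : Type} [AddCommMonoid M] [∀ i, Fintype (H i)] (j : ι)
    (g : (∀ i : {i // i ≠ j}, H i) → H j → M) :
    ∑ x : (∀ i, H i), g (fun i => x i) (x j) = ∑ r, ∑ b, g r b := by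
  rw [Finset.sum_comm, ← Fintype.sum_prod_type', ← (Equiv.piSplitAt j H).sum_comp]
  rfl

theorem tensorOp_mul_loneTensor [∀ i, Fintype (H i)] (j : ι) (K : ∀ i, Matrix (H' i) (H i) ℂ)
    (V : Matrix (∀ i : {i // i ≠ j}, H i) κ ℂ) (β : Matrix (H j) Unit ℂ) :
    tensorOp K * loneTensor j V β
      = loneTensor j (tensorOp (fun i : {i // i ≠ j} => K i) * V) (K j * β) := by
  ext x k
  simp only [Matrix.mul_apply, loneTensor, Matrix.of_apply, tensorOp]
  rw [Finset.sum_mul_sum, ← sum_pi_eq_sum_sum_ne j]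
  refine Finset.sum_congr rfl fun y _ => ?_
  rw [Fintype.prod_eq_mul_prod_subtype_ne _ j]
  ring

theorem frob_loneTensor [∀ i, Fintype (H i)] [Fintype κ] (j : ι)
    (V : Matrix (∀ i : {i // i ≠ j}, H i) κ ℂ) (β : Matrix (H j) Unit ℂ) :
    frob (loneTensor j V β) = frob V * frob β := by
  rw [← sq_eq_sq₀ (frob_nonneg _) (mul_nonneg (frob_nonneg _) (frob_nonneg _)), mul_pow, frob_sq,
    frob_sq, frob_sq, Finset.sum_mul_sum, ← sum_pi_eq_sum_sum_ne j]
  refine Finset.sum_congr rfl fun y _ => ?_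
  simp only [loneTensor, Matrix.of_apply, norm_mul, mul_pow, Finset.univ_unique,
    Finset.sum_singleton, Finset.sum_mul]

end Bipartition

/-! ### A separately subadditive lower bound for the error -/

/-- The lower bound for the error of a protocol, in terms of the norms of the local vectors. -/
noncomputable def overlapDefect (x y : Fin 3 → ℝ) : ℝ :=
  1 / 2 * (y 2 ^ 2 * (x 0 - x 1) ^ 2 + x 2 ^ 2 * (y 1 - y 2) ^ 2 + y 0 ^ 2 * (x 1 - x 2) ^ 2 +
    x 0 ^ 2 * (y 0 - y 1) ^ 2)

/-- The norms of three local vectors are comparable. -/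
def NormBalanced (x : Fin 3 → ℝ) : Prop :=
  x 0 ≤ 2 * x 1 ∧ x 1 ≤ 2 * x 0 ∧ x 1 ≤ 2 * x 2 ∧ x 2 ≤ 2 * x 1

/-- Reverse triangle inequality in `ℓ²`: by Cauchy–Schwarz the cross term `∑ f g` is at most `F *
G`. -/
theorem sub_sq_le_sum_sub_sq {O : Type} [Fintype O] (f g : O → ℝ) {F G : ℝ} (hF : 0 ≤ F)
    (hG : 0 ≤ G) (hf : ∑ a, f a ^ 2 = F ^ 2) (hg : ∑ a, g a ^ 2 = G ^ 2) :
    (F - G) ^ 2 ≤ ∑ a, (f a - g a) ^ 2 := by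
  have h : ∑ a, f a * g a ≤ F * G := by
    refine abs_le_of_sq_le_sq' ?_ (mul_nonneg hF hG) |>.2
    rw [mul_pow, ← hf, ← hg]
    exact Finset.sum_mul_sq_le_sq_mul_sq _ _ _
  have h2 : ∑ a, (f a - g a) ^ 2 = F ^ 2 - 2 * ∑ a, f a * g a + G ^ 2 := by
    rw [← hf, ← hg, Finset.mul_sum, ← Finset.sum_sub_distrib, ← Finset.sum_add_distrib]
    exact Finset.sum_congr rfl fun a _ => by ring
  rw [h2]
  nlinarith

/-- The terms with a plain factor `x u ^ 2` are conserved by the measurement, and those with a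
squared difference can only grow. -/
theorem overlapDefect_le_sum_left {O : Type} [Fintype O] (f : O → Fin 3 → ℝ) (x y : Fin 3 → ℝ)
    (hx : ∀ u, 0 ≤ x u) (hf : ∀ u, ∑ a, f a u ^ 2 = x u ^ 2) :
    overlapDefect x y ≤ ∑ a, overlapDefect (f a) y := by
  have h01 := sub_sq_le_sum_sub_sq _ _ (hx 0) (hx 1) (hf 0) (hf 1)
  have h12 := sub_sq_le_sum_sub_sq _ _ (hx 1) (hx 2) (hf 1) (hf 2)
  simp only [overlapDefect]
  rw [← Finset.mul_sum, Finset.sum_add_distrib, Finset.sum_add_distrib, Finset.sum_add_distrib,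
    ← Finset.mul_sum, ← Finset.mul_sum, ← Finset.sum_mul, ← Finset.sum_mul, hf, hf]
  gcongr

theorem overlapDefect_le_sum_right {O : Type} [Fintype O] (f : O → Fin 3 → ℝ) (x y : Fin 3 → ℝ)
    (hy : ∀ u, 0 ≤ y u) (hf : ∀ u, ∑ a, f a u ^ 2 = y u ^ 2) :
    overlapDefect x y ≤ ∑ a, overlapDefect x (f a) := by
  have h01 := sub_sq_le_sum_sub_sq _ _ (hy 0) (hy 1) (hf 0) (hf 1)
  have h12 := sub_sq_le_sum_sub_sq _ _ (hy 1) (hy 2) (hf 1) (hf 2)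
  simp only [overlapDefect]
  rw [← Finset.mul_sum, Finset.sum_add_distrib, Finset.sum_add_distrib, Finset.sum_add_distrib,
    ← Finset.mul_sum, ← Finset.mul_sum, ← Finset.sum_mul, ← Finset.sum_mul, hf, hf]
  gcongr

/-! ### Constants for balanced and unbalanced norms -/

/-- The worst case is an end of the chain 0–1–2, where two doublings give `1 + 4 + 16 = 21`. -/
theorem NormBalanced.sum_sq_le {x : Fin 3 → ℝ} (h : NormBalanced x) (hx : ∀ u, 0 ≤ x u) (u : Fin 3) :
    ∑ v, x v ^ 2 ≤ 21 * x u ^ 2 := by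
  obtain ⟨h1, h2, h3, h4⟩ := h
  have e1 := pow_le_pow_left₀ (hx 0) h1 2
  have e2 := pow_le_pow_left₀ (hx 1) h2 2
  have e3 := pow_le_pow_left₀ (hx 1) h3 2
  have e4 := pow_le_pow_left₀ (hx 2) h4 2
  rw [Fin.sum_univ_three]
  rw [mul_pow] at e1 e2 e3 e4
  have p0 := sq_nonneg (x 0)
  have p1 := sq_nonneg (x 1)
  have p2 := sq_nonneg (x 2)
  fin_cases u <;> simp only [Fin.zero_eta, Fin.mk_one, Fin.reduceFinMk] <;> linarith

theorem sum_sq_le_of_two_mul_lt {a b c : ℝ} (ha : 0 ≤ a) (hb : 0 ≤ b)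
    (h : 2 * b < a ∨ 2 * a < b) :
    a ^ 2 + b ^ 2 + c ^ 2 ≤ 13 * ((a - b) ^ 2 + (b - c) ^ 2) := by
  rcases h with h | h
  · nlinarith [mul_nonneg ha hb, mul_nonneg (sub_pos.2 h).le hb, mul_nonneg (sub_pos.2 h).le ha,
      sq_nonneg (2 * b - c)]
  · nlinarith [mul_nonneg ha hb, mul_nonneg (sub_pos.2 h).le hb, mul_nonneg (sub_pos.2 h).le ha,
      -- As a function of `c`, the expression `13 * (b - c) ^ 2 - c ^ 2` is minimal at `c = 13 * b /
      -- 12`.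
      sq_nonneg (13 * b - 12 * c)]

theorem sum_sq_le_of_not_balanced {x : Fin 3 → ℝ} (h : ¬ NormBalanced x) (hx : ∀ u, 0 ≤ x u) :
    ∑ v, x v ^ 2 ≤ 13 * ((x 0 - x 1) ^ 2 + (x 1 - x 2) ^ 2) := by
  rw [Fin.sum_univ_three]
  by_cases h' : 2 * x 1 < x 0 ∨ 2 * x 0 < x 1
  · exact sum_sq_le_of_two_mul_lt (hx 0) (hx 1) h'
  · have h'' : 2 * x 1 < x 2 ∨ 2 * x 2 < x 1 := by
      by_contra hc
      push Not at h' hc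
      exact h ⟨h'.1, h'.2, hc.2, hc.1⟩
    -- The inequality is symmetric under reversal of the chain, so the large ratio may be placed at
    -- either end.
    have := sum_sq_le_of_two_mul_lt (c := x 0) (hx 2) (hx 1) h''
    nlinarith

/-- Only the two terms with differences of `x` are kept. The constant is `546 = 2 * 13 * 21`: the
prefactor `1 / 2`, the loss from imbalance of `x`, and the comparison of `y 0`, `y 2` with the total
norm. -/
theorem le_overlapDefect_of_not_balanced_left {x y : Fin 3 → ℝ} (hx : ∀ u, 0 ≤ x u)
    (hy : ∀ u, 0 ≤ y u) (hbx : ¬ NormBalanced x) (hby : NormBalanced y) :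
    (∑ u, x u ^ 2) * (∑ w, y w ^ 2) / 546 ≤ overlapDefect x y := by
  have h1 := sum_sq_le_of_not_balanced hbx hx
  have h20 := hby.sum_sq_le hy 0
  have h22 := hby.sum_sq_le hy 2
  have hS : 0 ≤ ∑ w, y w ^ 2 := by positivity
  have h3 := mul_le_mul_of_nonneg_right h1 hS
  have h4 := mul_le_mul_of_nonneg_right h20 (sq_nonneg (x 1 - x 2))
  have h5 := mul_le_mul_of_nonneg_right h22 (sq_nonneg (x 0 - x 1))
  have h6 : 0 ≤ x 2 ^ 2 * (y 1 - y 2) ^ 2 := by positivity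
  have h7 : 0 ≤ x 0 ^ 2 * (y 0 - y 1) ^ 2 := by positivity
  rw [overlapDefect]
  linarith

theorem le_overlapDefect_of_not_balanced_right {x y : Fin 3 → ℝ} (hx : ∀ u, 0 ≤ x u)
    (hy : ∀ u, 0 ≤ y u) (hbx : NormBalanced x) (hby : ¬ NormBalanced y) :
    (∑ u, x u ^ 2) * (∑ w, y w ^ 2) / 546 ≤ overlapDefect x y := by
  have h1 := sum_sq_le_of_not_balanced hby hy
  have h20 := hbx.sum_sq_le hx 0
  have h22 := hbx.sum_sq_le hx 2
  have hS : 0 ≤ ∑ w, x w ^ 2 := by positivity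
  have h3 := mul_le_mul_of_nonneg_left h1 hS
  have h4 := mul_le_mul_of_nonneg_right h20 (sq_nonneg (y 0 - y 1))
  have h5 := mul_le_mul_of_nonneg_right h22 (sq_nonneg (y 1 - y 2))
  have h6 : 0 ≤ y 2 ^ 2 * (x 0 - x 1) ^ 2 := by positivity
  have h7 : 0 ≤ y 0 ^ 2 * (x 1 - x 2) ^ 2 := by positivity
  rw [overlapDefect]
  linarith

-- One round as two steps. If the outcome `r` unbalances `f r`, the defect is estimated against the
-- still balanced `y` and only then distributed over `b`; hence no estimate is needed with both
-- sides unbalanced.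
open Classical in
theorem mul_sum_sq_le_sum_sum {R B : Type} [Fintype R] [Fintype B] (f : R → Fin 3 → ℝ)
    (g : B → Fin 3 → ℝ) {x y : Fin 3 → ℝ} (hf0 : ∀ r u, 0 ≤ f r u) (hy : ∀ w, 0 ≤ y w)
    (hby : NormBalanced y) (hf : ∀ u, ∑ r, f r u ^ 2 = x u ^ 2)
    (hg : ∀ w, ∑ b, g b w ^ 2 = y w ^ 2) :
    (∑ u, x u ^ 2) * (∑ w, y w ^ 2) / 546 ≤ ∑ r, ∑ b,
      if NormBalanced (f r) then (∑ u, f r u ^ 2) * (∑ w, g b w ^ 2) / 546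
        else overlapDefect (f r) (g b) := by
  have hr : ∀ r, (∑ u, f r u ^ 2) * (∑ w, y w ^ 2) / 546 ≤ ∑ b,
      if NormBalanced (f r) then (∑ u, f r u ^ 2) * (∑ w, g b w ^ 2) / 546
        else overlapDefect (f r) (g b) := fun r => by
    split_ifs with h
    · rw [← Finset.sum_div, ← Finset.mul_sum, Finset.sum_comm]
      simp only [hg, le_refl]
    · exact (le_overlapDefect_of_not_balanced_left (hf0 r) hy h hby).trans
        (overlapDefect_le_sum_right _ _ _ hy hg)
  refine le_trans (le_of_eq ?_) (Finset.sum_le_sum fun r _ => hr r)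
  rw [← Finset.sum_div, ← Finset.sum_mul, Finset.sum_comm]
  simp only [hf]

/-! ### The error of a protocol on the domino states -/

section Domino

variable {ι κ X : Type} [Fintype ι] [DecidableEq ι] {H : ι → Type} [∀ i, Fintype (H i)]

/-- The four pairs `(V₀ ± V₁) ⊗ β₂`, `V₂ ⊗ (β₁ ± β₂)`, `(V₁ ± V₂) ⊗ β₀`, `V₀ ⊗ (β₀ ± β₁)`, up to
the factor `1/√2`. -/
noncomputable def domino (j : ι) (V : Fin 3 → Matrix (∀ i : {i // i ≠ j}, H i) κ ℂ)
    (β : Fin 3 → Matrix (H j) Unit ℂ) (q : Fin 4 × Bool) : Matrix (∀ i, H i) κ ℂ :=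
  pmComb (loneTensor j (V (![0, 2, 1, 0] q.1)) (β (![2, 1, 0, 0] q.1)))
    (loneTensor j (V (![1, 2, 2, 0] q.1)) (β (![2, 2, 0, 1] q.1))) q.2

theorem tensorOp_mul_domino {H' : ι → Type} (j : ι) (K : ∀ i, Matrix (H' i) (H i) ℂ)
    (V : Fin 3 → Matrix (∀ i : {i // i ≠ j}, H i) κ ℂ) (β : Fin 3 → Matrix (H j) Unit ℂ)
    (q : Fin 4 × Bool) :
    tensorOp K * domino j V β q
      = domino j (fun u => tensorOp (fun i : {i // i ≠ j} => K i) * V u) (fun w => K j * β w) q := by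
  simp only [domino, mul_pmComb, tensorOp_mul_loneTensor]

variable [DecidableEq X] [Fintype κ]

/-- By injectivity of `lab` the announcement `y` matches at most one sign, and the other member is
lost. -/
theorem le_pair_error (lab : Fin 4 × Bool → X) (hlab : Function.Injective lab) (y : X) (l : Fin 4)
    (P Q : Matrix (∀ i, H i) κ ℂ) :
    1 / 2 * (frob P - frob Q) ^ 2 ≤
      ∑ s, if y = lab (l, s) then 0 else frob (pmComb P Q s) ^ 2 := by
  have ht := le_frob_pmComb_sq P Q true
  have hf := le_frob_pmComb_sq P Q false
  have pt := sq_nonneg (frob (pmComb P Q true))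
  have pf := sq_nonneg (frob (pmComb P Q false))
  rw [Fintype.sum_bool]
  split_ifs with h1 h2 h2
  · exact absurd (hlab (h1.symm.trans h2)) (by simp)
  all_goals linarith

variable [∀ i, DecidableEq (H i)]

/-- The sum of the probabilities of a wrong identification of the eight domino states. -/
noncomputable def dominoError (lab : Fin 4 × Bool → X) (P : LOCC ι X H) (j : ι)
    (V : Fin 3 → Matrix (∀ i : {i // i ≠ j}, H i) κ ℂ) (β : Fin 3 → Matrix (H j) Unit ℂ) : ℝ :=
  ∑ q, (frob (domino j V β q) ^ 2 - P.prob (domino j V β q * (domino j V β q)ᴴ) (lab q))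

theorem dominoError_round (lab : Fin 4 × Bool → X) (k e : ι → ℕ)
    (K : ∀ i, Fin (k i) → Matrix (Fin (e i)) (H i) ℂ) (hK : ∀ i, ∑ a, (K i a)ᴴ * K i a = 1)
    (next : (∀ i, Fin (k i)) → LOCC ι X (fun i => Fin (e i))) (j : ι)
    (V : Fin 3 → Matrix (∀ i : {i // i ≠ j}, H i) κ ℂ) (β : Fin 3 → Matrix (H j) Unit ℂ) :
    dominoError lab (LOCC.round k e K hK next) j V β = ∑ a : (∀ i, Fin (k i)),
      dominoError lab (next a) j
        (fun u => tensorOp (fun i : {i // i ≠ j} => K i (a i)) * V u) (fun w => K j (a j) * β w) := by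
  simp only [dominoError]
  rw [Finset.sum_comm]
  refine Finset.sum_congr rfl fun q _ => ?_
  rw [LOCC.prob_round, ← sum_frob_sq_tensorOp_mul K hK, ← Finset.sum_sub_distrib]
  refine Finset.sum_congr rfl fun a _ => ?_
  rw [tensorOp_mul_domino]

theorem dominoError_guess (lab : Fin 4 × Bool → X) (y : X) (j : ι)
    (V : Fin 3 → Matrix (∀ i : {i // i ≠ j}, H i) κ ℂ) (β : Fin 3 → Matrix (H j) Unit ℂ) :
    dominoError lab (LOCC.guess y) j V β =
      ∑ l, ∑ s, if y = lab (l, s) then 0 else frob (domino j V β (l, s)) ^ 2 := by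
  rw [dominoError, Fintype.sum_prod_type]
  refine Finset.sum_congr rfl fun l _ => Finset.sum_congr rfl fun s _ => ?_
  rw [LOCC.prob_guess]
  split_ifs <;> simp

theorem overlapDefect_le_dominoError (lab : Fin 4 × Bool → X) (hlab : Function.Injective lab)
    (P : LOCC ι X H) (j : ι) (V : Fin 3 → Matrix (∀ i : {i // i ≠ j}, H i) κ ℂ)
    (β : Fin 3 → Matrix (H j) Unit ℂ) :
    overlapDefect (fun u => frob (V u)) (fun w => frob (β w)) ≤ dominoError lab P j V β := by
  induction P with
  | guess y =>
    rw [dominoError_guess, Fin.sum_univ_four]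
    have h : ∀ l, _ := fun l => le_pair_error lab hlab y l
      (loneTensor j (V (![0, 2, 1, 0] l)) (β (![2, 1, 0, 0] l)))
      (loneTensor j (V (![1, 2, 2, 0] l)) (β (![2, 2, 0, 1] l)))
    have h0 := h 0
    have h1 := h 1
    have h2 := h 2
    have h3 := h 3
    rw [frob_loneTensor, frob_loneTensor] at h0 h1 h2 h3
    refine le_trans (le_of_eq ?_) (add_le_add (add_le_add (add_le_add h0 h1) h2) h3)
    simp [overlapDefect]
    ring
  | round k e K hK next ih =>
    rw [dominoError_round]
    refine le_trans ?_ (Finset.sum_le_sum fun a _ => ih a _ _)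
    -- Subadditivity holds in each argument separately, so it is applied to the others' outcomes and
    -- then to those of `j`.
    rw [sum_pi_eq_sum_sum_ne (H := fun i => Fin (k i)) j
      (fun r b => overlapDefect (fun u => frob (tensorOp (fun i : {i // i ≠ j} => K i (r i)) * V u))
        (fun w => frob (K j b * β w)))]
    refine (overlapDefect_le_sum_left
      (fun (r : ∀ i : {i // i ≠ j}, Fin (k i)) u =>
        frob (tensorOp (fun i : {i // i ≠ j} => K i (r i)) * V u)) _ _ (fun u => frob_nonneg _)
      (fun u => sum_frob_sq_tensorOp_mul (fun i : {i // i ≠ j} => K i) (fun i => hK i) (V u))).trans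
      (Finset.sum_le_sum fun r _ => ?_)
    exact overlapDefect_le_sum_right (fun b w => frob (K j b * β w)) _ _ (fun u => frob_nonneg _)
      (fun w => sum_frob_sq_mul (K j) (hK j) (β w))

theorem NormBalanced.le_dominoError_guess (lab : Fin 4 × Bool → X) (hlab : Function.Injective lab)
    (y : X) (j : ι) (V : Fin 3 → Matrix (∀ i : {i // i ≠ j}, H i) κ ℂ)
    (β : Fin 3 → Matrix (H j) Unit ℂ) (hV : NormBalanced fun u => frob (V u))
    (hβ : NormBalanced fun w => frob (β w)) :
    (∑ u, frob (V u) ^ 2) * (∑ w, frob (β w) ^ 2) / 546 ≤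
      dominoError lab (LOCC.guess y) j V β := by
  rw [dominoError_guess]
  have hS0 : 0 ≤ ∑ u, frob (V u) ^ 2 := Finset.sum_nonneg fun _ _ => sq_nonneg _
  have hR0 : 0 ≤ ∑ w, frob (β w) ^ 2 := Finset.sum_nonneg fun _ _ => sq_nonneg _
  have hSV := hV.sum_sq_le fun u => frob_nonneg _
  have hRβ := hβ.sum_sq_le fun w => frob_nonneg _
  generalize ∑ u, frob (V u) ^ 2 = S at *
  generalize ∑ w, frob (β w) ^ 2 = R at *
  -- Here `441 = 21 ^ 2`, one factor 21 for each side.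
  have hm : ∀ u w, S * R / 441 ≤ frob (loneTensor j (V u) (β w)) ^ 2 := fun u w => by
    have h3 := mul_le_mul (hSV u) (hRβ w) hR0 (mul_nonneg (by norm_num) (sq_nonneg _))
    rw [frob_loneTensor, mul_pow]
    linarith
  -- A single announcement cannot lie in both pairs 0 and 1, so one pair is missed completely; it
  -- contributes at least `2 * S * R / 441`, more than `S * R / 546`.
  obtain ⟨l, hl⟩ : ∃ l : Fin 4, ∀ s, y ≠ lab (l, s) := by
    by_contra! hc
    obtain ⟨s, hs⟩ := hc 0
    obtain ⟨t, ht⟩ := hc 1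
    exact absurd (hlab (hs.symm.trans ht)) (by simp)
  refine le_trans ?_ (Finset.single_le_sum (f := fun l => ∑ s, if y = lab (l, s) then 0
    else frob (domino j V β (l, s)) ^ 2) (fun l _ => Finset.sum_nonneg fun s _ => by
      split_ifs <;> positivity) (Finset.mem_univ l))
  simp only [hl, if_false]
  rw [Fintype.sum_bool, domino, domino, frob_pmComb_sq_add]
  refine le_trans ?_ (add_le_add (hm _ _) (hm _ _))
  linarith [mul_nonneg hS0 hR0]

/-- As long as both sides are balanced, the error is bounded below by a constant. -/
theorem NormBalanced.le_dominoError (lab : Fin 4 × Bool → X) (hlab : Function.Injective lab)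
    (P : LOCC ι X H) (j : ι) (V : Fin 3 → Matrix (∀ i : {i // i ≠ j}, H i) κ ℂ)
    (β : Fin 3 → Matrix (H j) Unit ℂ) (hV : NormBalanced fun u => frob (V u))
    (hβ : NormBalanced fun w => frob (β w)) :
    (∑ u, frob (V u) ^ 2) * (∑ w, frob (β w) ^ 2) / 546 ≤ dominoError lab P j V β := by
  induction P with
  | guess y => exact hV.le_dominoError_guess lab hlab y j V β hβ
  | round k e K hK next ih =>
    classical
    rw [dominoError_round]
    refine (mul_sum_sq_le_sum_sum
      (fun (r : ∀ i : {i // i ≠ j}, Fin (k i)) u =>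
        frob (tensorOp (fun i : {i // i ≠ j} => K i (r i)) * V u))
      (fun b w => frob (K j b * β w)) (fun r u => frob_nonneg _) (fun w => frob_nonneg (β w)) hβ
      (fun u => sum_frob_sq_tensorOp_mul (fun i : {i // i ≠ j} => K i) (fun i => hK i) (V u))
      (fun w => sum_frob_sq_mul (K j) (hK j) (β w))).trans ?_
    rw [← sum_pi_eq_sum_sum_ne (H := fun i => Fin (k i)) j]
    refine Finset.sum_le_sum fun a _ => ?_
    split_ifs with h
    · by_cases hb : NormBalanced fun w => frob (K j (a j) * β w)
      · exact ih a _ _ h hb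
      · refine le_trans ?_ (overlapDefect_le_dominoError lab hlab (next a) j _ _)
        exact le_overlapDefect_of_not_balanced_right (fun u => frob_nonneg _)
          (fun w => frob_nonneg _) h hb
    -- The defect was already charged before `j` measured, so the balance of the new norms of `j` is
    -- irrelevant.
    · exact overlapDefect_le_dominoError lab hlab (next a) j _ _

end Domino

/-! ### Joint states of the form `W * Wᴴ` -/

section Resource

variable {ι S κ : Type} {D : ι → ℕ} {d : S → ℕ}

/-- The tensor product of `ψ` with a square root `C` of the resource state. -/
def resourceVec (ψ : (∀ j, Fin (D j)) → ℂ) (own : S → ι) (C : Matrix (∀ s, Fin (d s)) κ ℂ) :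
    Matrix (∀ j, PartySpace D own d j) κ ℂ :=
  Matrix.of fun x k => ψ (fun j => (x j).1) * C (fun s => (x (own s)).2 ⟨s, rfl⟩) k

/-- The column index acts as an inert purifying system, so a mixed resource is handled by vector
norms. -/
theorem jointState_mul_conjTranspose [Fintype κ] (ψ : (∀ j, Fin (D j)) → ℂ) (own : S → ι)
    (C : Matrix (∀ s, Fin (d s)) κ ℂ) :
    jointState ψ own (C * Cᴴ) = resourceVec ψ own C * (resourceVec ψ own C)ᴴ := by
  ext x y
  simp only [jointState, pureState, resourceVec, Matrix.of_apply, Matrix.vecMulVec_apply,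
    Matrix.mul_apply, Matrix.conjTranspose_apply, Finset.mul_sum, star_mul', Pi.star_apply]
  exact Finset.sum_congr rfl fun k _ => by ring

open scoped MatrixOrder in
theorem exists_sqrt_of_isDensity {S : Type} [Fintype S] [DecidableEq S] {ρ : Matrix S S ℂ}
    (hρ : IsDensity ρ) : ∃ C : Matrix S S ℂ, ρ = C * Cᴴ ∧ frob C ^ 2 = 1 := by
  obtain ⟨B, hB⟩ := CStarAlgebra.nonneg_iff_eq_star_mul_self.1 hρ.1.nonneg
  rw [Matrix.star_eq_conjTranspose] at hB
  refine ⟨Bᴴ, by rw [Matrix.conjTranspose_conjTranspose, hB], ?_⟩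
  rw [frob_sq_eq_trace, Matrix.conjTranspose_conjTranspose, ← hB, hρ.2, Complex.one_re]

/-- The joint basis, with the resource separated from the state to be identified. -/
def partySpaceEquiv (D : ι → ℕ) (own : S → ι) (d : S → ℕ) :
    (∀ j, PartySpace D own d j) ≃ (∀ j, Fin (D j)) × (∀ s, Fin (d s)) where
  toFun x := (fun j => (x j).1, fun s => (x (own s)).2 ⟨s, rfl⟩)
  invFun y := fun j => (y.1 j, fun s => y.2 s)
  left_inv x := by
    funext j
    refine Prod.ext rfl (funext fun s => ?_)
    obtain ⟨s, rfl⟩ := s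
    rfl
  right_inv y := rfl

theorem frob_resourceVec_sq [Fintype ι] [DecidableEq ι] [Fintype S] [DecidableEq S] [Fintype κ]
    (ψ : (∀ j, Fin (D j)) → ℂ) (own : S → ι) (C : Matrix (∀ s, Fin (d s)) κ ℂ) :
    frob (resourceVec ψ own C) ^ 2 = (∑ y, ‖ψ y‖ ^ 2) * frob C ^ 2 := by
  rw [frob_sq, frob_sq, Finset.sum_mul_sum]
  refine Eq.trans ?_ (Fintype.sum_prod_type' _)
  rw [← (partySpaceEquiv D own d).sum_comp]
  refine Finset.sum_congr rfl fun x _ => ?_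
  simp only [resourceVec, Matrix.of_apply, norm_mul, mul_pow, ← Finset.mul_sum]
  rfl

/-- Product vectors of basis vectors. -/
def basisVec [Fintype ι] (D n : ι → ℕ) : (∀ j, Fin (D j)) → ℂ := fun y =>
  ∏ k, ket (D k) (n k) (y k)

theorem basisVec_apply [Fintype ι] (D n : ι → ℕ) (y : ∀ j, Fin (D j)) :
    basisVec D n y = if ∀ k, (y k).val = n k then 1 else 0 := by
  simp only [basisVec, ket, Finset.prod_ite_zero, Finset.mem_univ, true_implies, Finset.prod_const_one]

theorem sum_norm_basisVec_sq [Fintype ι] [DecidableEq ι] (D n : ι → ℕ) (hn : ∀ k, n k < D k) :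
    ∑ y, ‖basisVec D n y‖ ^ 2 = 1 := by
  rw [Finset.sum_eq_single fun k => ⟨n k, hn k⟩]
  · simp [basisVec_apply]
  · intro y _ hy
    rw [basisVec_apply, if_neg]
    · simp
    · exact fun h => hy (funext fun k => Fin.ext (h k))
  · simp

theorem sum_norm_comb_basisVec_sq [Fintype ι] [DecidableEq ι] (D n n' : ι → ℕ)
    (hn : ∀ k, n k < D k) (hn' : ∀ k, n' k < D k) (hne : n ≠ n') (s : Bool) :
    ∑ y, ‖((Real.sqrt 2 : ℝ) : ℂ)⁻¹ *
      (basisVec D n y + (if s then 1 else -1) * basisVec D n' y)‖ ^ 2 = 1 := by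
  have h : ∀ y, ‖((Real.sqrt 2 : ℝ) : ℂ)⁻¹ *
      (basisVec D n y + (if s then 1 else -1) * basisVec D n' y)‖ ^ 2
      = 1 / 2 * (‖basisVec D n y‖ ^ 2 + ‖basisVec D n' y‖ ^ 2) := fun y => by
    rw [norm_mul, mul_pow, norm_inv_sqrt_two_sq, basisVec_apply, basisVec_apply]
    congr 1
    by_cases h1 : ∀ k, (y k).val = n k
    · have h2 : ¬ ∀ k, (y k).val = n' k := fun h2 =>
        hne (funext fun k => (h1 k).symm.trans (h2 k))
      rw [if_pos h1, if_neg h2]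
      simp
    · rw [if_neg h1]
      cases s <;> split_ifs <;> simp
  simp only [h]
  rw [← Finset.mul_sum, Finset.sum_add_distrib, sum_norm_basisVec_sq D n hn,
    sum_norm_basisVec_sq D n' hn']
  norm_num

/-- The factor of a product vector that belongs to a party without a share of the resource. -/
def loneVec (D : ι → ℕ) (own : S → ι) (d : S → ℕ) (j : ι) (a : ℕ) :
    Matrix (PartySpace D own d j) Unit ℂ :=
  Matrix.of fun y _ => ket (D j) a y.1

/-- The factor of a product vector that belongs to the parties other than `j`. -/
def restVec [Fintype ι] [DecidableEq ι] (D : ι → ℕ) (own : S → ι) (C : Matrix (∀ s, Fin (d s)) κ ℂ)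
    (j : ι) (hj : ∀ s, own s ≠ j) (n : ι → ℕ) :
    Matrix (∀ i : {i // i ≠ j}, PartySpace D own d i) κ ℂ :=
  Matrix.of fun z k => (∏ i : {i // i ≠ j}, ket (D i) (n i) (z i).1) *
    C (fun s => (z ⟨own s, hj s⟩).2 ⟨s, rfl⟩) k

/-- As `j` owns no subsystem, `C` depends only on coordinates of the others, and the joint vector is
a product across the cut. -/
theorem resourceVec_basisVec [Fintype ι] [DecidableEq ι] (own : S → ι)
    (C : Matrix (∀ s, Fin (d s)) κ ℂ) (j : ι) (hj : ∀ s, own s ≠ j) (n : ι → ℕ) :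
    resourceVec (basisVec D n) own C
      = loneTensor j (restVec D own C j hj n) (loneVec D own d j (n j)) := by
  ext x k
  simp only [resourceVec, loneTensor, restVec, loneVec, basisVec, Matrix.of_apply]
  rw [Fintype.prod_eq_mul_prod_subtype_ne _ j]
  ring

theorem restVec_congr [Fintype ι] [DecidableEq ι] (own : S → ι)
    (C : Matrix (∀ s, Fin (d s)) κ ℂ) (j : ι) (hj : ∀ s, own s ≠ j) (n n' : ι → ℕ)
    (h : ∀ i, i ≠ j → n i = n' i) : restVec D own C j hj n = restVec D own C j hj n' := by
  ext z k
  simp only [restVec, Matrix.of_apply]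
  congr 1
  exact Finset.prod_congr rfl fun i _ => by rw [h i i.2]

end Resource

/-- Swapping the terms changes the vector at most by a global sign, which the state does not see. -/
theorem pmComb_comm_mul_conjTranspose {A κ : Type} [Fintype κ] (P Q : Matrix A κ ℂ) (s : Bool) :
    pmComb P Q s * (pmComb P Q s)ᴴ = pmComb Q P s * (pmComb Q P s)ᴴ := by
  have h : pmComb P Q s = (if s then (1 : ℂ) else -1) • pmComb Q P s := by
    cases s
    · simp only [pmComb, Bool.false_eq_true, if_false]
      module
    · simp only [pmComb, if_true]
      module
  rw [h, Matrix.conjTranspose_smul, Matrix.smul_mul, Matrix.mul_smul, smul_smul]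
  cases s <;> simp

/-- The error of every protocol on normalized domino states is bounded below. -/
theorem le_dominoError_of_frob_eq_one {ι κ X : Type} [Fintype ι] [DecidableEq ι] {H : ι → Type}
    [∀ i, Fintype (H i)] [∀ i, DecidableEq (H i)] [DecidableEq X] [Fintype κ]
    (lab : Fin 4 × Bool → X) (hlab : Function.Injective lab) (P : LOCC ι X H) (j : ι)
    (V : Fin 3 → Matrix (∀ i : {i // i ≠ j}, H i) κ ℂ) (β : Fin 3 → Matrix (H j) Unit ℂ)
    (h : ∀ u w, frob (loneTensor j (V u) (β w)) = 1) :
    9 / 546 ≤ dominoError lab P j V β := by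
  simp only [frob_loneTensor] at h
  have hβ0 : ∀ w, frob (β w) ≠ 0 := fun w h0 => by simpa [h0] using h 0 w
  have hV0 : ∀ u, frob (V u) ≠ 0 := fun u h0 => by simpa [h0] using h u 0
  have hV : ∀ u, frob (V u) = frob (V 0) := fun u =>
    mul_right_cancel₀ (hβ0 0) ((h u 0).trans (h 0 0).symm)
  have hβ : ∀ w, frob (β w) = frob (β 0) := fun w =>
    mul_left_cancel₀ (hV0 0) ((h 0 w).trans (h 0 0).symm)
  have hb : ∀ x : Fin 3 → ℝ, (∀ u, 0 ≤ x u) → (∀ u, x u = x 0) → NormBalanced x := by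
    intro x hx0 hx
    have := hx0 0
    have h1 := hx 1
    have h2 := hx 2
    refine ⟨?_, ?_, ?_, ?_⟩ <;> linarith
  refine le_trans (le_of_eq ?_) ((hb _ (fun u => frob_nonneg _) hV).le_dominoError lab hlab P j V β
    (hb _ (fun w => frob_nonneg _) hβ))
  -- The product of the two sums consists of nine terms equal to 1.
  simp only [Finset.sum_mul_sum, ← mul_pow, h]
  simp
  norm_num

/-! ### The set of product states -/

section GStates

variable {m : ℕ}

/-- Indices of the basis vectors of Alice and of Bob-`i`, the other Bobs being in the state
number 2. -/
def pairIdx (i : Fin m) (a b : ℕ) : Fin (m + 1) → ℕ :=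
  Fin.cases a fun k => if k = i then b else 2

/-- The basis vectors in the first term of a state of the set. -/
def GLabel.fstIdx : GLabel m → Fin (m + 1) → ℕ
  | .zero => Fin.cases 0 fun _ => 2
  | .one i => pairIdx i (i + 2) 1
  | .two i => pairIdx i 1 0
  | .three i => pairIdx i 0 0

/-- The basis vectors in the second term of a state of the set. -/
def GLabel.sndIdx : GLabel m → Fin (m + 1) → ℕ
  | .zero => Fin.cases 1 fun _ => 2
  | .one i => pairIdx i (i + 2) 2
  | .two i => pairIdx i (i + 2) 0
  | .three i => pairIdx i 0 1

theorem pairIdx_lt (i : Fin m) {a b : ℕ} (ha : a < m + 2) (hb : b < 3) (k : Fin (m + 1)) :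
    pairIdx i a b k < gDim m k := by
  refine Fin.cases ?_ (fun k => ?_) k
  · exact ha
  · simp only [pairIdx, gDim, Fin.cases_succ]
    split_ifs <;> omega

theorem pairIdx_two (i : Fin m) (a : ℕ) : pairIdx i a 2 = Fin.cases a fun _ => 2 := by
  funext k
  refine Fin.cases rfl (fun k => ?_) k
  simp [pairIdx]

theorem GLabel.fstIdx_lt (l : GLabel m) (k : Fin (m + 1)) : l.fstIdx k < gDim m k := by
  cases l with
  | zero =>
    refine Fin.cases ?_ (fun k => ?_) k
    · simp [fstIdx, gDim]
    · simp [fstIdx, gDim]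
  | one i => exact pairIdx_lt i (by omega) (by omega) k
  | two i => exact pairIdx_lt i (by omega) (by omega) k
  | three i => exact pairIdx_lt i (by omega) (by omega) k

theorem GLabel.sndIdx_lt (l : GLabel m) (k : Fin (m + 1)) : l.sndIdx k < gDim m k := by
  cases l with
  | zero =>
    refine Fin.cases ?_ (fun k => ?_) k
    · simp [sndIdx, gDim]
    · simp [sndIdx, gDim]
  | one i => exact pairIdx_lt i (by omega) (by omega) k
  | two i => exact pairIdx_lt i (by omega) (by omega) k
  | three i => exact pairIdx_lt i (by omega) (by omega) k

theorem GLabel.fstIdx_ne_sndIdx (l : GLabel m) : l.fstIdx ≠ l.sndIdx := by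
  intro h
  cases l with
  | zero => simpa [fstIdx, sndIdx] using congrFun h 0
  | one i => simpa [fstIdx, sndIdx, pairIdx] using congrFun h i.succ
  | two i => simpa [fstIdx, sndIdx, pairIdx] using congrFun h 0
  | three i => simpa [fstIdx, sndIdx, pairIdx] using congrFun h i.succ

theorem basisVec_pairIdx (i : Fin m) (a b : ℕ) (y : ∀ j, Fin (gDim m j)) :
    basisVec (gDim m) (pairIdx i a b) y = ket (m + 2) a (y 0) * (ket 3 b (y i.succ) *
      ∏ k ∈ Finset.univ.erase i, ket 3 2 (y k.succ)) := by
  rw [basisVec, Fin.prod_univ_succ, ← Finset.mul_prod_erase _ _ (Finset.mem_univ i)]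
  have h : ∏ k ∈ Finset.univ.erase i, ket (gDim m k.succ) (pairIdx i a b k.succ) (y k.succ)
      = ∏ k ∈ Finset.univ.erase i, ket 3 2 (y k.succ) :=
    Finset.prod_congr rfl fun k hk => by
      have : pairIdx i a b k.succ = 2 := by simp [pairIdx, Finset.ne_of_mem_erase hk]
      rw [this]
      rfl
  have hi : pairIdx i a b i.succ = b := by simp [pairIdx]
  rw [h, hi]
  rfl

theorem prod_ite_bob (i : Fin m) (f g : Fin 3 → ℂ) (y : ∀ j, Fin (gDim m j)) :
    ∏ k : Fin m, (if k = i then f else g) (y k.succ) = f (y i.succ) *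
      ∏ k ∈ Finset.univ.erase i, g (y k.succ) := by
  rw [← Finset.mul_prod_erase _ _ (Finset.mem_univ i), if_pos rfl]
  congr 1
  exact Finset.prod_congr rfl fun k hk => by rw [if_neg (Finset.ne_of_mem_erase hk)]

theorem gState_eq (l : GLabel m) (s : Bool) (y : ∀ j, Fin (gDim m j)) :
    gState m (l, s) y = ((Real.sqrt 2 : ℝ) : ℂ)⁻¹ * (basisVec (gDim m) l.fstIdx y +
      (if s then 1 else -1) * basisVec (gDim m) l.sndIdx y) := by
  rw [gState, Fin.prod_univ_succ]
  cases l with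
  | zero =>
    rw [basisVec, basisVec, Fin.prod_univ_succ, Fin.prod_univ_succ]
    change ketPM (m + 2) 0 1 s (y 0) * ∏ k : Fin m, ket 3 2 (y k.succ) = _ *
      (ket (m + 2) 0 (y 0) * ∏ k : Fin m, ket 3 2 (y k.succ) +
        _ * (ket (m + 2) 1 (y 0) * ∏ k : Fin m, ket 3 2 (y k.succ)))
    simp only [ketPM]
    ring
  | one i =>
    rw [GLabel.fstIdx, GLabel.sndIdx, basisVec_pairIdx, basisVec_pairIdx]
    change ket (m + 2) (i + 2) (y 0) *
      ∏ k : Fin m, (if k = i then ketPM 3 1 2 s else ket 3 2) (y k.succ) = _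
    rw [prod_ite_bob]
    simp only [ketPM]
    ring
  | two i =>
    rw [GLabel.fstIdx, GLabel.sndIdx, basisVec_pairIdx, basisVec_pairIdx]
    change ketPM (m + 2) 1 (i + 2) s (y 0) *
      ∏ k : Fin m, (if k = i then ket 3 0 else ket 3 2) (y k.succ) = _
    rw [prod_ite_bob]
    simp only [ketPM]
    ring
  | three i =>
    rw [GLabel.fstIdx, GLabel.sndIdx, basisVec_pairIdx, basisVec_pairIdx]
    change ket (m + 2) 0 (y 0) *
      ∏ k : Fin m, (if k = i then ketPM 3 0 1 s else ket 3 2) (y k.succ) = _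
    rw [prod_ite_bob]
    simp only [ketPM]
    ring

theorem sum_norm_gState_sq (x : GLabel m × Bool) : ∑ y, ‖gState m x y‖ ^ 2 = 1 := by
  obtain ⟨l, s⟩ := x
  simp only [gState_eq]
  exact sum_norm_comb_basisVec_sq _ _ _ l.fstIdx_lt l.sndIdx_lt l.fstIdx_ne_sndIdx s

/-! ### Domino states inside the set -/

theorem resourceVec_gState {S κ : Type} {d : S → ℕ} (own : S → Fin (m + 1))
    (C : Matrix (∀ s, Fin (d s)) κ ℂ) (l : GLabel m) (s : Bool) :
    resourceVec (gState m (l, s)) own C = pmComb (resourceVec (basisVec (gDim m) l.fstIdx) own C)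
      (resourceVec (basisVec (gDim m) l.sndIdx) own C) s := by
  ext x k
  simp only [resourceVec, gState_eq, pmComb, Matrix.of_apply, Matrix.smul_apply, Matrix.add_apply,
    smul_eq_mul]
  ring

/-- If a party has no share of the resource, then the joint states contain the domino states of
that party and the others. -/
theorem exists_domino_eq_jointState {S : Type} [Fintype S] [DecidableEq S] {d : S → ℕ} (hm : 1 ≤ m)
    (own : S → Fin (m + 1)) (ρ : Matrix (∀ s, Fin (d s)) (∀ s, Fin (d s)) ℂ) (hρ : IsDensity ρ)
    (j : Fin (m + 1)) (hj : ∀ s, own s ≠ j) :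
    ∃ (lab : Fin 4 × Bool → GLabel m × Bool)
      (V : Fin 3 → Matrix (∀ i : {i // i ≠ j}, PartySpace (gDim m) own d i) (∀ s, Fin (d s)) ℂ)
      (β : Fin 3 → Matrix (PartySpace (gDim m) own d j) Unit ℂ),
      Function.Injective lab ∧ (∀ u w, frob (loneTensor j (V u) (β w)) = 1) ∧
        ∀ q, domino j V β q * (domino j V β q)ᴴ = jointState (gState m (lab q)) own ρ := by
  obtain ⟨C, rfl, hC⟩ := exists_sqrt_of_isDensity hρ
  have hone : ∀ n : Fin (m + 1) → ℕ, (∀ k, n k < gDim m k) →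
      frob (resourceVec (basisVec (gDim m) n) own C) = 1 := fun n hn => by
    rw [← sq_eq_sq₀ (frob_nonneg _) zero_le_one, frob_resourceVec_sq, sum_norm_basisVec_sq _ _ hn,
      hC]
    norm_num
  have hcongr : ∀ n n' : Fin (m + 1) → ℕ, (∀ i, i ≠ j → n i = n' i) →
      loneTensor j (restVec (gDim m) own C j hj n) (loneVec (gDim m) own d j (n' j)) =
        resourceVec (basisVec (gDim m) n') own C := fun n n' h => by
    rw [resourceVec_basisVec own C j hj, restVec_congr own C j hj n n' h]
  have hres := fun x : GLabel m × Bool => jointState_mul_conjTranspose (gState m x) own C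
  rcases Fin.eq_zero_or_eq_succ j with rfl | ⟨i, rfl⟩
  -- Alice is isolated: any Bob completes the pattern, and `1 ≤ m` provides one. Her vectors are
  -- taken in the order `i, q, p`.
  · have i : Fin m := ⟨0, hm⟩
    have hT : ∀ u w : Fin 3, loneTensor 0 (restVec (gDim m) own C 0 hj (pairIdx i 0 u))
        (loneVec (gDim m) own d 0 (![(i : ℕ) + 2, 1, 0] w)) =
        resourceVec (basisVec (gDim m) (pairIdx i (![(i : ℕ) + 2, 1, 0] w) u)) own C := fun u w =>
      hcongr (pairIdx i 0 u) (pairIdx i (![(i : ℕ) + 2, 1, 0] w) u) fun k hk => by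
        obtain ⟨k, rfl⟩ := Fin.exists_succ_eq.2 hk
        rfl
    refine ⟨fun q => (![.three i, .zero, .one i, .two i] q.1, q.2),
      fun u => restVec (gDim m) own C 0 hj (pairIdx i 0 u),
      fun w => loneVec (gDim m) own d 0 (![(i : ℕ) + 2, 1, 0] w), ?_, fun u w => ?_, ?_⟩
    · rintro ⟨l, s⟩ ⟨l', s'⟩ h
      obtain ⟨h1, rfl⟩ := Prod.mk.inj h
      fin_cases l <;> fin_cases l' <;> first | rfl | (simp at h1)
    · rw [hT]
      refine hone _ (pairIdx_lt i ?_ u.2)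
      fin_cases w <;> simp
    · rintro ⟨l, s⟩
      simp only [domino, hT]
      rw [hres, resourceVec_gState]
      fin_cases l
      · rfl
      -- With Alice's order reversed, the terms of the pairs `0` and `(i,2)` appear interchanged.
      · rw [pmComb_comm_mul_conjTranspose]
        simp [GLabel.fstIdx, GLabel.sndIdx, pairIdx_two]
      · rfl
      · rw [pmComb_comm_mul_conjTranspose]
        rfl
  -- Bob-`i` is isolated: his basis keeps its order, and the others are distinguished by Alice's
  -- vectors `p, q, i`.
  · have hT : ∀ u w : Fin 3,
        loneTensor i.succ (restVec (gDim m) own C i.succ hj (pairIdx i (![0, 1, (i : ℕ) + 2] u) 0))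
          (loneVec (gDim m) own d i.succ w) =
        resourceVec (basisVec (gDim m) (pairIdx i (![0, 1, (i : ℕ) + 2] u) w)) own C := fun u w => by
      have h := hcongr (pairIdx i (![0, 1, (i : ℕ) + 2] u) 0) (pairIdx i (![0, 1, (i : ℕ) + 2] u) w)
        fun k => Fin.cases (fun _ => rfl) (fun k hk => by
          have hk' : k ≠ i := fun h => hk (by rw [h])
          simp [pairIdx, hk']) k
      rw [← h]
      simp [pairIdx]
    refine ⟨fun q => (![.zero, .one i, .two i, .three i] q.1, q.2),
      fun u => restVec (gDim m) own C i.succ hj (pairIdx i (![0, 1, (i : ℕ) + 2] u) 0),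
      fun w => loneVec (gDim m) own d i.succ w, ?_, fun u w => ?_, ?_⟩
    · rintro ⟨l, s⟩ ⟨l', s'⟩ h
      obtain ⟨h1, rfl⟩ := Prod.mk.inj h
      fin_cases l <;> fin_cases l' <;> first | rfl | (simp at h1)
    · rw [hT]
      refine hone _ (pairIdx_lt i ?_ w.2)
      fin_cases u <;> simp
    · rintro ⟨l, s⟩
      simp only [domino, hT]
      rw [hres, resourceVec_gState]
      fin_cases l
      · simp [GLabel.fstIdx, GLabel.sndIdx, pairIdx_two]
      · rfl
      · rfl
      · rfl

/-- Without a share of the resource for every party, the probability of a correct identification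
stays away from 1. -/
theorem payoff_lt_one {S : Type} [Fintype S] [DecidableEq S] {d : S → ℕ} (hm : 1 ≤ m)
    (p : GLabel m × Bool → ℝ) (hp : ∀ x, 0 < p x) (hp1 : ∑ x, p x = 1)
    (own : S → Fin (m + 1)) (ρ : Matrix (∀ s, Fin (d s)) (∀ s, Fin (d s)) ℂ) (hρ : IsDensity ρ)
    (j : Fin (m + 1)) (hj : ∀ s, own s ≠ j) :
    payoff p (gState m) own ρ < 1 := by
  have : Nonempty (GLabel m × Bool) := ⟨(.zero, true)⟩
  obtain ⟨x₀, hx₀⟩ := Finite.exists_min p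
  have : Nonempty (LOCC (Fin (m + 1)) (GLabel m × Bool) (PartySpace (gDim m) own d)) :=
    ⟨.guess x₀⟩
  suffices h : payoff p (gState m) own ρ ≤ 1 - p x₀ * (9 / 546) by
    have := hp x₀
    linarith
  refine ciSup_le fun P => ?_
  have hle : ∀ x, P.prob (jointState (gState m x) own ρ) x ≤ 1 := fun x => by
    obtain ⟨C, rfl, hC⟩ := exists_sqrt_of_isDensity hρ
    rw [jointState_mul_conjTranspose]
    refine (P.prob_le _ _).trans (le_of_eq ?_)
    rw [frob_resourceVec_sq, sum_norm_gState_sq, hC, one_mul]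
  obtain ⟨lab, V, β, hlab, hone, hD⟩ := exists_domino_eq_jointState hm own ρ hρ j hj
  have herr := le_dominoError_of_frob_eq_one lab hlab P j V β hone
  have hfrob : ∀ q, frob (domino j V β q) ^ 2 = 1 := fun q => by
    obtain ⟨C, rfl, hC⟩ := exists_sqrt_of_isDensity hρ
    rw [frob_sq_eq_trace, hD, jointState_mul_conjTranspose, ← frob_sq_eq_trace,
      frob_resourceVec_sq, sum_norm_gState_sq, hC, one_mul]
  simp only [dominoError, hfrob, hD] at herr
  -- States outside the domino pattern have nonnegative error and are dropped; each prior is at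
  -- least the minimal one.
  have h1 : p x₀ * ∑ q, (1 - P.prob (jointState (gState m (lab q)) own ρ) (lab q)) ≤
      ∑ x, p x * (1 - P.prob (jointState (gState m x) own ρ) x) := by
    rw [Finset.mul_sum]
    calc _ ≤ ∑ q, p (lab q) * (1 - P.prob (jointState (gState m (lab q)) own ρ) (lab q)) :=
          Finset.sum_le_sum fun q _ => mul_le_mul_of_nonneg_right (hx₀ _) (sub_nonneg.2 (hle _))
      _ = ∑ x ∈ Finset.univ.map ⟨lab, hlab⟩,
            p x * (1 - P.prob (jointState (gState m x) own ρ) x) := by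
          rw [Finset.sum_map]
          rfl
      _ ≤ _ := Finset.sum_le_sum_of_subset_of_nonneg (Finset.subset_univ _) fun x _ _ =>
          mul_nonneg (hp x).le (sub_nonneg.2 (hle _))
  have h2 := mul_le_mul_of_nonneg_left herr (hp x₀).le
  have h3 : ∑ x, p x * (1 - P.prob (jointState (gState m x) own ρ) x) =
      1 - ∑ x, p x * P.prob (jointState (gState m x) own ρ) x := by
    simp only [mul_sub, mul_one, Finset.sum_sub_distrib, hp1]
  linarith

end GStates

/-! ### Perfect discrimination by LOCC -/

theorem tensorOp_submatrix_mul {ι κ : Type} [Fintype ι] [DecidableEq ι] {H H' E : ι → Type}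
    [∀ i, Fintype (H i)] [∀ i, Fintype (E i)] (e : ∀ i, E i ≃ H i)
    (K : ∀ i, Matrix (H' i) (H i) ℂ) (W : Matrix (∀ i, H i) κ ℂ) :
    tensorOp (fun i => (K i).submatrix id (e i)) * W.submatrix (fun x i => e i (x i)) id
      = tensorOp K * W := by
  ext x k
  simp only [Matrix.mul_apply, tensorOp, Matrix.of_apply, Matrix.submatrix_apply, id]
  exact (Equiv.piCongrRight e).sum_comp fun y => (∏ i, K i (x i) (y i)) * W y k

theorem frob_submatrix_equiv {A B κ : Type} [Fintype A] [Fintype B] [Fintype κ] (e : A ≃ B)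
    (W : Matrix B κ ℂ) : frob (W.submatrix e id) = frob W := by
  rw [← sq_eq_sq₀ (frob_nonneg _) (frob_nonneg _), frob_sq, frob_sq, ← e.sum_comp]
  rfl

/-- The permutation operator of `τ`. -/
def permOp {A : Type} [DecidableEq A] (τ : Equiv.Perm A) : Matrix A A ℂ :=
  Matrix.of fun y z => if τ y = z then 1 else 0

/-- The projection onto the eigenspace of the permutation operator with the eigenvalue `c`,
if `τ` is an involution and `c = ±1`. -/
noncomputable def eigenProj {A : Type} [DecidableEq A] (τ : Equiv.Perm A) (c : ℝ) : Matrix A A ℂ :=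
  (2⁻¹ : ℂ) • (1 + (c : ℂ) • permOp τ)

section Involution

variable {A : Type} [DecidableEq A] {τ : Equiv.Perm A}

theorem conjTranspose_eigenProj (hτ : ∀ y, τ (τ y) = y) (c : ℝ) :
    (eigenProj τ c)ᴴ = eigenProj τ c := by
  have h : (permOp τ)ᴴ = permOp τ := by
    ext y z
    have : τ z = y ↔ τ y = z := ⟨fun h => by rw [← h, hτ], fun h => by rw [← h, hτ]⟩
    simp [permOp, Matrix.conjTranspose_apply, this]
  simp [eigenProj, Matrix.conjTranspose_smul, Matrix.conjTranspose_add, h]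

variable [Fintype A]

theorem permOp_mul_self (hτ : ∀ y, τ (τ y) = y) : permOp τ * permOp τ = 1 := by
  ext y z
  rw [Matrix.mul_apply, Finset.sum_eq_single (τ y)]
  · simp [permOp, Matrix.one_apply, hτ]
  · intro w _ hw
    simp [permOp, Ne.symm hw]
  · simp

theorem eigenProj_mul_permOp (hτ : ∀ y, τ (τ y) = y) {c : ℝ} (hc : c * c = 1) :
    eigenProj τ c * permOp τ = (c : ℂ) • eigenProj τ c := by
  have hc' : (c : ℂ) * c = 1 := by exact_mod_cast hc
  simp only [eigenProj, Matrix.smul_mul, Matrix.add_mul, Matrix.one_mul, permOp_mul_self hτ,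
    smul_add, smul_smul]
  rw [add_comm, mul_left_comm, hc', mul_one, mul_comm (c : ℂ)]

theorem eigenProj_mul_self (hτ : ∀ y, τ (τ y) = y) {c : ℝ} (hc : c * c = 1) :
    eigenProj τ c * eigenProj τ c = eigenProj τ c := by
  have hc' : (c : ℂ) * c = 1 := by exact_mod_cast hc
  nth_rw 2 [eigenProj]
  rw [Matrix.mul_smul, Matrix.mul_add, Matrix.mul_smul, eigenProj_mul_permOp hτ hc, Matrix.mul_one,
    smul_smul, hc']
  module

end Involution

section Perfect

variable {ι X κ : Type} [Fintype ι] [DecidableEq ι] [DecidableEq X] [Fintype κ]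
  {H : ι → Type} [∀ i, Fintype (H i)] [∀ i, DecidableEq (H i)]

/-- Some LOCC protocol identifies the members of the family `F` without error. -/
def PerfectlyDistinguishable (F : X → Matrix (∀ i, H i) κ ℂ) : Prop :=
  ∃ P : LOCC ι X H, ∀ x, P.prob (F x * (F x)ᴴ) x = frob (F x) ^ 2

theorem PerfectlyDistinguishable.of_guess (F : X → Matrix (∀ i, H i) κ ℂ) (x₀ : X)
    (h : ∀ x, x ≠ x₀ → F x = 0) : PerfectlyDistinguishable F := by
  refine ⟨.guess x₀, fun x => ?_⟩
  rw [LOCC.prob_guess]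
  split_ifs with hx
  · rfl
  · rw [h x (Ne.symm hx), frob_sq]
    simp

/-- Rounds end in spaces with basis `Fin (e i)`; this allows natural bases to be kept throughout the
protocol. -/
theorem PerfectlyDistinguishable.reindex {E : ι → Type} [∀ i, Fintype (E i)]
    [∀ i, DecidableEq (E i)] (e : ∀ i, E i ≃ H i) {F : X → Matrix (∀ i, H i) κ ℂ}
    (h : PerfectlyDistinguishable F) :
    PerfectlyDistinguishable fun x => (F x).submatrix (fun (y : ∀ i, E i) i => e i (y i)) id := by
  have hfrob : ∀ x, frob ((F x).submatrix (fun (y : ∀ i, E i) i => e i (y i)) id) = frob (F x) :=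
    fun x => frob_submatrix_equiv (Equiv.piCongrRight e) (F x)
  obtain ⟨P, hP⟩ := h
  cases P with
  | guess y =>
    refine ⟨.guess y, fun x => ?_⟩
    have := hP x
    rw [LOCC.prob_guess] at this ⊢
    rw [hfrob, this]
  | round k d K hK next =>
    refine ⟨.round k d (fun i a => (K i a).submatrix id (e i)) (fun i => ?_) next, fun x => ?_⟩
    · have := congrArg (fun M => M.submatrix (e i) (e i)) (hK i)
      simp only [Matrix.submatrix_one_equiv] at this
      rw [← this]
      ext y z
      simp [Matrix.sum_apply, Matrix.mul_apply]
    · rw [hfrob, ← hP, LOCC.prob_round, LOCC.prob_round]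
      refine Finset.sum_congr rfl fun a _ => ?_
      exact congrArg (fun M => (next a).prob (M * Mᴴ) x)
        (tensorOp_submatrix_mul e (fun i => K i (a i)) (F x))

/-- A round in which every party applies Kraus operators on its space. -/
theorem PerfectlyDistinguishable.of_round {k : ι → ℕ} (K : ∀ i, Fin (k i) → Matrix (H i) (H i) ℂ)
    (hK : ∀ i, ∑ a, (K i a)ᴴ * K i a = 1) (F : X → Matrix (∀ i, H i) κ ℂ)
    (h : ∀ a : (∀ i, Fin (k i)),
      PerfectlyDistinguishable fun x => (tensorOp fun i => K i (a i)) * F x) :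
    PerfectlyDistinguishable F := by
  have h' := fun a => (h a).reindex fun i => (Fintype.equivFin (H i)).symm
  choose next hnext using h'
  refine ⟨.round k (fun i => Fintype.card (H i))
    (fun i a => (K i a).submatrix (Fintype.equivFin (H i)).symm id) (fun i => ?_) next, fun x => ?_⟩
  · rw [← hK i]
    refine Finset.sum_congr rfl fun a _ => ?_
    rw [Matrix.conjTranspose_submatrix, Matrix.submatrix_mul_equiv, Matrix.submatrix_id_id]
  · rw [LOCC.prob_round, ← sum_frob_sq_tensorOp_mul K hK]
    refine Finset.sum_congr rfl fun a _ => ?_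
    have e1 : (tensorOp fun i => (K i (a i)).submatrix (Fintype.equivFin (H i)).symm id) * F x =
        ((tensorOp fun i => K i (a i)) * F x).submatrix
          (fun y i => (Fintype.equivFin (H i)).symm (y i)) id := by
      ext y k
      simp [Matrix.mul_apply, tensorOp]
    rw [e1, hnext a x]
    congr 1
    exact frob_submatrix_equiv (Equiv.piCongrRight fun i => (Fintype.equivFin (H i)).symm) _

/-- A round in which every party measures a function of its basis. -/
theorem PerfectlyDistinguishable.of_measure {N : ℕ} (g : ∀ i, H i → Fin N)
    (F : X → Matrix (∀ i, H i) κ ℂ)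
    (h : ∀ a : ι → Fin N, PerfectlyDistinguishable fun x =>
      Matrix.of fun y k => if ∀ i, g i (y i) = a i then F x y k else 0) :
    PerfectlyDistinguishable F := by
  refine .of_round (k := fun _ => N)
    (fun i a => Matrix.diagonal fun y => if g i y = a then 1 else 0) (fun i => ?_) F fun a => ?_
  · ext y z
    rw [Matrix.sum_apply]
    simp only [Matrix.diagonal_conjTranspose, Matrix.diagonal_mul_diagonal]
    by_cases hyz : y = z
    · subst hyz
      simp
    · simp [hyz]
  · convert h a using 2 with x
    ext y k
    rw [Matrix.mul_apply, Matrix.of_apply, Finset.sum_eq_single y]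
    · simp only [tensorOp, Matrix.of_apply, Matrix.diagonal_apply_eq, Finset.prod_ite_zero,
        Finset.mem_univ, true_implies, Finset.prod_const_one]
      split_ifs <;> simp
    · intro z _ hz
      obtain ⟨i, hi⟩ := Function.ne_iff.1 hz
      rw [tensorOp, Matrix.of_apply, Finset.prod_eq_zero (Finset.mem_univ i), zero_mul]
      exact Matrix.diagonal_apply_ne _ (Ne.symm hi)
    · simp

/-- Two states that are even and odd under a product of local involutions are distinguished by
measuring every involution. -/
theorem PerfectlyDistinguishable.of_involutive (τ : ∀ i, Equiv.Perm (H i))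
    (hτ : ∀ i y, τ i (τ i y) = y) (F : X → Matrix (∀ i, H i) κ ℂ) (x : Bool → X)
    (h0 : ∀ y, (∀ s, y ≠ x s) → F y = 0)
    (h : ∀ s y k, F (x s) (fun i => τ i (y i)) k = (if s then 1 else -1) * F (x s) y k) :
    PerfectlyDistinguishable F := by
  let sgn : Fin 2 → ℝ := ![1, -1]
  have hsgn : ∀ a, sgn a * sgn a = 1 := fun a => by fin_cases a <;> simp [sgn]
  refine .of_round (k := fun _ => 2) (fun i a => eigenProj (τ i) (sgn a)) (fun i => ?_) F
    fun a => ?_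
  · rw [Fin.sum_univ_two, conjTranspose_eigenProj (hτ i), conjTranspose_eigenProj (hτ i),
      eigenProj_mul_self (hτ i) (hsgn 0), eigenProj_mul_self (hτ i) (hsgn 1)]
    simp only [eigenProj, sgn, Matrix.cons_val_zero, Matrix.cons_val_one, Complex.ofReal_neg,
      Complex.ofReal_one]
    module
  -- The product of the permutation operators acts on the projected state both by the product of the
  -- measured signs and by the sign of the state. If these differ, the projection vanishes.
  · have hT : ∀ s, ((∏ i, sgn (a i) : ℝ) : ℂ) •
          ((tensorOp fun i => eigenProj (τ i) (sgn (a i))) * F (x s)) =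
        (if s then (1 : ℂ) else -1) •
          ((tensorOp fun i => eigenProj (τ i) (sgn (a i))) * F (x s)) := fun s => by
      have hF : tensorOp (fun i => permOp (τ i)) * F (x s) =
          (if s then (1 : ℂ) else -1) • F (x s) := by
        ext y k
        rw [Matrix.mul_apply, Finset.sum_eq_single fun i => τ i (y i)]
        · simp [tensorOp, permOp, h]
        · intro z _ hz
          obtain ⟨i, hi⟩ := Function.ne_iff.1 hz
          rw [tensorOp, Matrix.of_apply, Finset.prod_eq_zero (Finset.mem_univ i), zero_mul]
          exact if_neg (Ne.symm hi)
        · simp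
      have hKT : tensorOp (fun i => eigenProj (τ i) (sgn (a i))) * tensorOp (fun i => permOp (τ i)) =
          ((∏ i, sgn (a i) : ℝ) : ℂ) • tensorOp fun i => eigenProj (τ i) (sgn (a i)) := by
        rw [tensorOp_mul]
        ext y z
        simp only [eigenProj_mul_permOp (hτ _) (hsgn _), tensorOp, Matrix.of_apply,
          Matrix.smul_apply, smul_eq_mul, Finset.prod_mul_distrib, Complex.ofReal_prod]
      rw [← Matrix.smul_mul, ← hKT, Matrix.mul_assoc, hF, Matrix.mul_smul]
    have hprod : (∏ i, sgn (a i)) = 1 ∨ (∏ i, sgn (a i)) = -1 := by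
      rw [← mul_self_eq_one_iff, ← Finset.prod_mul_distrib]
      exact Finset.prod_eq_one fun i _ => hsgn _
    have h2 : ∀ W : Matrix (∀ i, H i) κ ℂ, (1 : ℂ) • W = (-1 : ℂ) • W → W = 0 := fun W hW => by
      ext y k
      have := congrFun (congrFun hW y) k
      rw [one_smul, neg_one_smul, Matrix.neg_apply] at this
      exact self_eq_neg.1 this
    rcases hprod with hp | hp <;> rw [hp] at hT
    · refine .of_guess _ (x true) fun y hy => ?_
      by_cases hyf : y = x false
      · rw [hyf]
        exact h2 _ (by simpa using hT false)
      · rw [h0 y fun s => by cases s <;> assumption, Matrix.mul_zero]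
    · refine .of_guess _ (x false) fun y hy => ?_
      by_cases hyf : y = x true
      · rw [hyf]
        exact h2 _ (by simpa using (hT true).symm)
      · rw [h0 y fun s => by cases s <;> assumption, Matrix.mul_zero]

/-- The family `F` with all amplitudes outside `E` removed. -/
noncomputable def restrictTo (E : Set (∀ i, H i)) (F : X → Matrix (∀ i, H i) κ ℂ) (x : X) :
    Matrix (∀ i, H i) κ ℂ :=
  Matrix.of fun y k => E.indicator (fun y => F x y k) y

/-- Basis measurements only delete amplitudes, so the set `E` of surviving basis vectors records the
whole history. -/
theorem PerfectlyDistinguishable.restrictTo_of_measure {N : ℕ} (g : ∀ i, H i → Fin N)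
    (E : Set (∀ i, H i)) (F : X → Matrix (∀ i, H i) κ ℂ)
    (h : ∀ a : ι → Fin N,
      PerfectlyDistinguishable (restrictTo (E ∩ {y | ∀ i, g i (y i) = a i}) F)) :
    PerfectlyDistinguishable (restrictTo E F) := by
  classical
  refine .of_measure g _ fun a => ?_
  convert h a using 1
  funext x
  ext y k
  simp only [restrictTo, Matrix.of_apply, Set.indicator_apply, Set.mem_inter_iff,
    Set.mem_ofPred_eq]
  split_ifs <;> simp_all

theorem PerfectlyDistinguishable.restrictTo_of_involutive (τ : ∀ i, Equiv.Perm (H i))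
    (hτ : ∀ i y, τ i (τ i y) = y) (E : Set (∀ i, H i)) (F : X → Matrix (∀ i, H i) κ ℂ)
    (x : Bool → X) (h0 : ∀ y ∈ E, ∀ x' k, F x' y k ≠ 0 → ∃ s, x' = x s)
    (h : ∀ y ∈ E, ∀ s k, F (x s) y k ≠ 0 → (fun i => τ i (y i)) ∈ E ∧
      F (x s) (fun i => τ i (y i)) k = (if s then 1 else -1) * F (x s) y k) :
    PerfectlyDistinguishable (restrictTo E F) := by
  classical
  refine .of_involutive τ hτ _ x (fun x' hx' => ?_) fun s y k => ?_
  · ext y k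
    simp only [restrictTo, Matrix.of_apply, Matrix.zero_apply, Set.indicator_apply_eq_zero]
    intro hy
    by_contra hne
    obtain ⟨s, hs⟩ := h0 y hy x' k hne
    exact hx' s hs
  · simp only [restrictTo, Matrix.of_apply]
    by_cases hy : y ∈ E ∧ F (x s) y k ≠ 0
    · obtain ⟨h1, h2⟩ := h y hy.1 s k hy.2
      rw [Set.indicator_of_mem h1, Set.indicator_of_mem hy.1, h2]
    -- Where the amplitude vanishes it must vanish at the image too: otherwise applying `h` at the
    -- image would return a nonzero amplitude here.
    · have hz : E.indicator (fun y => F (x s) y k) y = 0 := by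
        rw [Set.indicator_apply_eq_zero]
        intro hyE
        by_contra hne
        exact hy ⟨hyE, hne⟩
      rw [hz, mul_zero, Set.indicator_apply_eq_zero]
      intro hyE
      by_contra hne
      obtain ⟨h1, h2⟩ := h _ hyE s k hne
      simp only [hτ] at h1 h2
      refine hy ⟨h1, ?_⟩
      rw [h2]
      refine mul_ne_zero ?_ hne
      split_ifs <;> simp

theorem PerfectlyDistinguishable.restrictTo_of_eq_zero [Nonempty X] (E : Set (∀ i, H i))
    (F : X → Matrix (∀ i, H i) κ ℂ) (h0 : ∀ y ∈ E, ∀ x k, F x y k = 0) :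
    PerfectlyDistinguishable (restrictTo E F) := by
  refine .of_guess _ (Classical.arbitrary X) fun x _ => ?_
  ext y k
  simp only [restrictTo, Matrix.of_apply, Matrix.zero_apply, Set.indicator_apply_eq_zero]
  exact fun hy => h0 y hy x k

end Perfect

/-! ### Perfect discrimination with a GHZ state -/

theorem ghz_eq_of_forall_eq {n : ℕ} {y : Fin (n + 1) → Fin 2} {t : Fin 2} (h : ∀ j, y j = t) :
    ghz (n + 1) y = ((Real.sqrt 2 : ℝ) : ℂ)⁻¹ := by
  fin_cases t <;> simp_all [ghz]

theorem exists_forall_eq_of_ghz_ne_zero {n : ℕ} {y : Fin n → Fin 2} (h : ghz n y ≠ 0) :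
    ∃ t, ∀ j, y j = t := by
  by_contra! hc
  have h0 : ¬ ∀ j, y j = 0 := fun h => (hc 0).elim fun j hj => hj (h j)
  have h1 : ¬ ∀ j, y j = 1 := fun h => (hc 1).elim fun j hj => hj (h j)
  simp [ghz, h0, h1] at h

/-- The GHZ state as a matrix with one column. -/
noncomputable def ghzCol (n : ℕ) : Matrix (Fin n → Fin 2) Unit ℂ := Matrix.of fun y _ => ghz n y

theorem pureState_ghz (n : ℕ) : pureState (ghz n) = ghzCol n * (ghzCol n)ᴴ := by
  ext y z
  simp [pureState, ghzCol, Matrix.vecMulVec_apply, Matrix.mul_apply]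

theorem frob_ghzCol_sq (n : ℕ) : frob (ghzCol (n + 1)) ^ 2 = 1 := by
  have h : ∀ y : Fin (n + 1) → Fin 2, ‖ghz (n + 1) y‖ ^ 2 =
      1 / 2 * ((if y = fun _ => 0 then 1 else 0) + (if y = fun _ => 1 then 1 else 0)) := fun y => by
    rw [ghz, norm_mul, mul_pow, norm_inv_sqrt_two_sq]
    congr 1
    by_cases h0 : y = fun _ => 0
    · simp [h0, funext_iff]
    · by_cases h1 : y = fun _ => 1
      · simp [h1, funext_iff]
      · simp [h0, h1, ← funext_iff]
  rw [frob_sq]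
  simp only [ghzCol, Matrix.of_apply, Finset.univ_unique, Finset.sum_singleton, h]
  rw [← Finset.mul_sum, Finset.sum_add_distrib]
  simp
  norm_num

section Protocol

variable {m : ℕ}

/-- The space of the party `k`: its share of the state to be identified and one qubit. -/
abbrev GhzSpace (m : ℕ) (k : Fin (m + 1)) : Type :=
  PartySpace (gDim m) (id : Fin (m + 1) → Fin (m + 1)) (fun _ => 2) k

/-- The states of the set with a GHZ state. -/
noncomputable def ghzState (x : GLabel m × Bool) : Matrix (∀ k, GhzSpace m k) Unit ℂ :=
  resourceVec (gState m x) id (ghzCol (m + 1))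

/-- The basis vectors of the state `l`, together with those of the GHZ state. -/
def GLabel.InSupport (l : GLabel m) (y : ∀ k, GhzSpace m k) : Prop :=
  ((∀ k, (y k).1.val = l.fstIdx k) ∨ ∀ k, (y k).1.val = l.sndIdx k) ∧
    ∃ t, ∀ k, (y k).2 ⟨k, rfl⟩ = t

theorem ghzState_apply (l : GLabel m) (s : Bool) (y : ∀ k, GhzSpace m k) :
    ghzState (l, s) y () = ((Real.sqrt 2 : ℝ) : ℂ)⁻¹ *
      (basisVec (gDim m) l.fstIdx (fun k => (y k).1) +
        (if s then 1 else -1) * basisVec (gDim m) l.sndIdx fun k => (y k).1) *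
      ghz (m + 1) fun k => (y k).2 ⟨k, rfl⟩ := by
  simp only [ghzState, resourceVec, Matrix.of_apply, gState_eq, ghzCol]
  rfl

theorem inSupport_of_ghzState_ne_zero {l : GLabel m} {s : Bool} {y : ∀ k, GhzSpace m k}
    (h : ghzState (l, s) y () ≠ 0) : l.InSupport y := by
  rw [ghzState_apply, basisVec_apply, basisVec_apply] at h
  refine ⟨?_, exists_forall_eq_of_ghz_ne_zero (right_ne_zero_of_mul h)⟩
  by_contra hc
  rw [not_or] at hc
  refine left_ne_zero_of_mul h ?_
  rw [if_neg hc.1, if_neg hc.2]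
  simp

theorem ghzState_of_fst {l : GLabel m} {s : Bool} {y : ∀ k, GhzSpace m k} {t : Fin 2}
    (h : ∀ k, (y k).1.val = l.fstIdx k) (ht : ∀ k, (y k).2 ⟨k, rfl⟩ = t) :
    ghzState (l, s) y () = ((Real.sqrt 2 : ℝ) : ℂ)⁻¹ * ((Real.sqrt 2 : ℝ) : ℂ)⁻¹ := by
  have h' : ¬ ∀ k, (y k).1.val = l.sndIdx k := fun h' =>
    l.fstIdx_ne_sndIdx (funext fun k => (h k).symm.trans (h' k))
  rw [ghzState_apply, basisVec_apply, basisVec_apply, if_pos h, if_neg h', ghz_eq_of_forall_eq ht]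
  ring

theorem ghzState_of_snd {l : GLabel m} {s : Bool} {y : ∀ k, GhzSpace m k} {t : Fin 2}
    (h : ∀ k, (y k).1.val = l.sndIdx k) (ht : ∀ k, (y k).2 ⟨k, rfl⟩ = t) :
    ghzState (l, s) y () = (if s then 1 else -1) *
      (((Real.sqrt 2 : ℝ) : ℂ)⁻¹ * ((Real.sqrt 2 : ℝ) : ℂ)⁻¹) := by
  have h' : ¬ ∀ k, (y k).1.val = l.fstIdx k := fun h' =>
    l.fstIdx_ne_sndIdx (funext fun k => (h' k).symm.trans (h k))
  rw [ghzState_apply, basisVec_apply, basisVec_apply, if_pos h, if_neg h', ghz_eq_of_forall_eq ht]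
  ring

/-- The action on qubits of the symmetry of the pair `l`. -/
def GLabel.tagPerm : GLabel m → Equiv.Perm (Fin 2)
  | .two _ => Equiv.swap 0 1
  | _ => Equiv.refl _

/-- The local symmetries which exchange the two terms of the states with the name `l`. -/
def GLabel.exchange (l : GLabel m) (k : Fin (m + 1)) : Equiv.Perm (GhzSpace m k) :=
  Equiv.prodCongr (Equiv.swap ⟨l.fstIdx k, l.fstIdx_lt k⟩ ⟨l.sndIdx k, l.sndIdx_lt k⟩)
    (Equiv.piCongrRight fun _ => l.tagPerm)

theorem GLabel.exchange_exchange (l : GLabel m) (k : Fin (m + 1)) (y : GhzSpace m k) :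
    l.exchange k (l.exchange k y) = y := by
  have h : ∀ t, l.tagPerm (l.tagPerm t) = t := by
    cases l <;> simp [tagPerm]
  refine Prod.ext ?_ (funext fun s => h _)
  exact Equiv.swap_apply_self _ _ _

theorem exchange_fst_of_fst {l : GLabel m} {y : ∀ k, GhzSpace m k}
    (h : ∀ k, (y k).1.val = l.fstIdx k) (k : Fin (m + 1)) :
    (l.exchange k (y k)).1.val = l.sndIdx k := by
  have : (y k).1 = ⟨l.fstIdx k, l.fstIdx_lt k⟩ := Fin.ext (h k)
  change (Equiv.swap (⟨l.fstIdx k, l.fstIdx_lt k⟩ : Fin (gDim m k)) ⟨l.sndIdx k, l.sndIdx_lt k⟩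
    (y k).1).val = _
  rw [this, Equiv.swap_apply_left]

theorem exchange_fst_of_snd {l : GLabel m} {y : ∀ k, GhzSpace m k}
    (h : ∀ k, (y k).1.val = l.sndIdx k) (k : Fin (m + 1)) :
    (l.exchange k (y k)).1.val = l.fstIdx k := by
  have : (y k).1 = ⟨l.sndIdx k, l.sndIdx_lt k⟩ := Fin.ext (h k)
  change (Equiv.swap (⟨l.fstIdx k, l.fstIdx_lt k⟩ : Fin (gDim m k)) ⟨l.sndIdx k, l.sndIdx_lt k⟩
    (y k).1).val = _
  rw [this, Equiv.swap_apply_right]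

theorem exchange_snd {l : GLabel m} {y : ∀ k, GhzSpace m k} {t : Fin 2}
    (ht : ∀ k, (y k).2 ⟨k, rfl⟩ = t) (k : Fin (m + 1)) :
    (l.exchange k (y k)).2 ⟨k, rfl⟩ = l.tagPerm t :=
  congrArg l.tagPerm (ht k)

theorem GLabel.InSupport.exchange {l : GLabel m} {y : ∀ k, GhzSpace m k} (h : l.InSupport y) :
    l.InSupport fun k => l.exchange k (y k) := by
  obtain ⟨h1 | h1, t, ht⟩ := h
  · exact ⟨.inr (exchange_fst_of_fst h1), _, exchange_snd ht⟩
  · exact ⟨.inl (exchange_fst_of_snd h1), _, exchange_snd ht⟩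

theorem GLabel.InSupport.ghzState_exchange {l : GLabel m} {y : ∀ k, GhzSpace m k}
    (h : l.InSupport y) (s : Bool) :
    ghzState (l, s) (fun k => l.exchange k (y k)) () =
      (if s then 1 else -1) * ghzState (l, s) y () := by
  obtain ⟨h1 | h1, t, ht⟩ := h
  · rw [ghzState_of_fst h1 ht, ghzState_of_snd (exchange_fst_of_fst h1) (exchange_snd ht)]
  · rw [ghzState_of_snd h1 ht, ghzState_of_fst (exchange_fst_of_snd h1) (exchange_snd ht)]
    cases s <;> simp

/-- In the first round Alice compares her qubit with the subspace of `|p⟩` and `|q⟩`. -/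
def meas₁ (k : Fin (m + 1)) (z : GhzSpace m k) : Fin (m + 2) :=
  if k = 0 ∧ (z.1.val ≤ 1 ↔ z.2 ⟨k, rfl⟩ = 1) then 1 else 0

/-- In the second round Bob-`i` finds out whether the state is one of `(i,2)` and `(i,3)`. -/
def meas₂ (o : Fin (m + 2)) (k : Fin (m + 1)) (z : GhzSpace m k) : Fin (m + 2) :=
  if k ≠ 0 ∧ (z.1.val = 0 ∨ z.1.val = 1 ∧ (z.2 ⟨k, rfl⟩ = 1 ↔ o = 1)) then 1 else 0

/-- In the third round Alice finds out the rest of the name. -/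
def meas₃ (r : Fin (m + 1) → Fin (m + 2)) (k : Fin (m + 1)) (z : GhzSpace m k) : Fin (m + 2) :=
  if k = 0 then
    if ∀ i, r i = 0 then if z.1.val ≤ 1 then 0 else Fin.ofNat (m + 2) z.1.val
    else if z.1.val = 0 then 0 else 1
  else 0

/-- The outcomes of the second round for the name `l`. -/
def GLabel.bobOutcome : GLabel m → Fin (m + 1) → Fin (m + 2)
  | .zero => fun _ => 0
  | .one _ => fun _ => 0
  | .two i => fun k => if k = i.succ then 1 else 0
  | .three i => fun k => if k = i.succ then 1 else 0

/-- Alice's outcome of the third round for the name `l`. -/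
def GLabel.aliceOutcome : GLabel m → Fin (m + 2)
  | .zero => 0
  | .one i => i.succ.succ
  | .two _ => 1
  | .three _ => 0

/-- The Bobs' outcomes separate `0` and the `(i,1)` from the rest and reveal `i` for `(i,2)` and
`(i,3)`; Alice's outcome decides within each group. -/
theorem GLabel.outcome_injective {l l' : GLabel m} (h : l.bobOutcome = l'.bobOutcome)
    (h' : l.aliceOutcome = l'.aliceOutcome) : l = l' := by
  have key : ∀ i j : Fin m, (fun k => if k = i.succ then (1 : Fin (m + 2)) else 0) =
      (fun k => if k = j.succ then 1 else 0) → i = j := fun i j hij => by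
    have := congrFun hij i.succ
    by_contra hne
    simp [hne] at this
  have key0 : ∀ i : Fin m, (fun k => if k = i.succ then (1 : Fin (m + 2)) else 0) ≠
      fun _ => 0 := fun i hi => by
    simpa using congrFun hi i.succ
  cases l <;> cases l' <;> simp only [bobOutcome, aliceOutcome] at h h'
  case zero.zero => rfl
  case one.one => rw [Fin.succ_inj, Fin.succ_inj] at h'; rw [h']
  case two.two => rw [key _ _ h]
  case three.three => rw [key _ _ h]
  all_goals first
    | exact absurd h (key0 _)
    | exact absurd h.symm (key0 _)
    | exact absurd h' (by simp [Fin.ext_iff])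

theorem GLabel.InSupport.meas₂_eq {l : GLabel m} {y : ∀ k, GhzSpace m k} (h : l.InSupport y)
    (k : Fin (m + 1)) : meas₂ (meas₁ 0 (y 0)) k (y k) = l.bobOutcome k := by
  obtain ⟨h1, t, ht⟩ := h
  -- All qubits carry the same value, so comparing one's own qubit with Alice's first outcome tells
  -- whether her vector is `p` or `q`.
  have ho : ((y k).2 ⟨k, rfl⟩ = 1 ↔ meas₁ 0 (y 0) = 1) ↔ (y 0).1.val ≤ 1 := by
    rw [ht k, meas₁, ht 0]
    by_cases h1 : (y 0).1.val ≤ 1 <;> by_cases h2 : t = 1 <;> simp [h1, h2]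
  simp only [meas₂, ho]
  rcases h1 with h1 | h1 <;> simp only [h1] <;> clear h1 ho <;>
    refine Fin.cases ?_ (fun j => ?_) k <;> cases l <;>
    simp [bobOutcome, fstIdx, sndIdx, pairIdx, Ne.symm (Fin.succ_ne_zero _)] <;>
    split_ifs <;> simp_all

theorem GLabel.InSupport.meas₃_eq {l : GLabel m} {y : ∀ k, GhzSpace m k} (h : l.InSupport y)
    (k : Fin (m + 1)) :
    meas₃ l.bobOutcome k (y k) = if k = 0 then l.aliceOutcome else 0 := by
  by_cases hk : k = 0
  · subst hk
    have hi : ∀ i : Fin m, ¬ ∀ k, (if k = i.succ then (1 : Fin (m + 2)) else 0) = 0 := fun i h => by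
      simpa using h i.succ
    rcases h.1 with h1 | h1 <;> simp only [meas₃, h1, if_true] <;> cases l <;>
      simp only [bobOutcome, hi, implies_true, if_true, if_false] <;>
      simp [aliceOutcome, fstIdx, sndIdx, pairIdx, Fin.ext_iff, Fin.ofNat]
  · simp [meas₃, hk]

/-- Only for `(i,2)` does the exchange move Alice in or out of the span of `p` and `q`, and exactly
then it also flips the qubits. -/
theorem GLabel.InSupport.meas₁_exchange {l : GLabel m} {y : ∀ k, GhzSpace m k}
    (h : l.InSupport y) (k : Fin (m + 1)) : meas₁ k (l.exchange k (y k)) = meas₁ k (y k) := by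
  by_cases hk : k = 0
  · subst hk
    obtain ⟨h1 | h1, t, ht⟩ := h
    · simp only [meas₁, exchange_fst_of_fst h1, exchange_snd ht, h1, ht]
      cases l <;> fin_cases t <;> simp [tagPerm, fstIdx, sndIdx, pairIdx]
    · simp only [meas₁, exchange_fst_of_snd h1, exchange_snd ht, h1, ht]
      cases l <;> fin_cases t <;> simp [tagPerm, fstIdx, sndIdx, pairIdx]
  · simp [meas₁, hk]

theorem perfectlyDistinguishable_ghzState :
    PerfectlyDistinguishable (ghzState (m := m)) := by
  have : Nonempty (GLabel m × Bool) := ⟨(.zero, true)⟩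
  have huniv : (ghzState (m := m)) = restrictTo Set.univ ghzState := by
    funext x
    ext y k
    simp [restrictTo]
  rw [huniv]
  refine .restrictTo_of_measure meas₁ _ _ fun o => ?_
  refine .restrictTo_of_measure (meas₂ (o 0)) _ _ fun r => ?_
  refine .restrictTo_of_measure (meas₃ r) _ _ fun b => ?_
  have hE : ∀ y ∈ Set.univ ∩ {y : ∀ k, GhzSpace m k | ∀ k, meas₁ k (y k) = o k} ∩
      {y | ∀ k, meas₂ (o 0) k (y k) = r k} ∩ {y | ∀ k, meas₃ r k (y k) = b k},
      ∀ l : GLabel m, l.InSupport y → l.bobOutcome = r ∧ l.aliceOutcome = b 0 := by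
    rintro y ⟨⟨⟨-, h1⟩, h2⟩, h3⟩ l hl
    have hr : l.bobOutcome = r := funext fun k => by
      rw [← hl.meas₂_eq k, h1 0, h2 k]
    refine ⟨hr, ?_⟩
    rw [← h3 0, ← hr, hl.meas₃_eq, if_pos rfl]
  by_cases hl : ∃ l : GLabel m, l.bobOutcome = r ∧ l.aliceOutcome = b 0
  · obtain ⟨l, hr, hb⟩ := hl
    refine .restrictTo_of_involutive l.exchange l.exchange_exchange _ _ (fun s => (l, s))
      (fun y hy x k hne => ?_) fun y hy s k hne => ?_
    · obtain ⟨l', s⟩ := x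
      obtain ⟨hr', hb'⟩ := hE y hy l' (inSupport_of_ghzState_ne_zero hne)
      exact ⟨s, by rw [GLabel.outcome_injective (hr'.trans hr.symm) (hb'.trans hb.symm)]⟩
    · have hs := inSupport_of_ghzState_ne_zero hne
      refine ⟨?_, hs.ghzState_exchange s⟩
      obtain ⟨⟨⟨-, h1⟩, h2⟩, h3⟩ := hy
      have h1' : ∀ k, meas₁ k (l.exchange k (y k)) = o k := fun k => by
        rw [hs.meas₁_exchange, h1 k]
      refine ⟨⟨⟨trivial, h1'⟩, fun k => ?_⟩, fun k => ?_⟩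
      · rw [← h1' 0, hs.exchange.meas₂_eq k, hr]
      · rw [← h3 k, ← hr, hs.exchange.meas₃_eq k, hs.meas₃_eq k]
  -- These outcomes fit no name and occur with probability zero.
  · refine .restrictTo_of_eq_zero _ _ fun y hy x k => ?_
    by_contra hne
    exact hl ⟨x.1, hE y hy x.1 (inSupport_of_ghzState_ne_zero hne)⟩

/-- With the GHZ state the set of product states is discriminated perfectly. -/
theorem one_le_payoff_ghz (p : GLabel m × Bool → ℝ) (hp : ∀ x, 0 < p x) (hp1 : ∑ x, p x = 1) :
    1 ≤ payoff (d := fun _ : Fin (m + 1) => 2) p (gState m) id (pureState (ghz (m + 1))) := by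
  have hfrob : ∀ x : GLabel m × Bool, frob (ghzState x) ^ 2 = 1 := fun x => by
    rw [ghzState, frob_resourceVec_sq, sum_norm_gState_sq, frob_ghzCol_sq, one_mul]
  have hjoint : ∀ x : GLabel m × Bool, jointState (d := fun _ : Fin (m + 1) => 2) (gState m x) id
      (pureState (ghz (m + 1))) = ghzState x * (ghzState x)ᴴ := fun x => by
    rw [pureState_ghz, jointState_mul_conjTranspose]
    rfl
  obtain ⟨P, hP⟩ := perfectlyDistinguishable_ghzState (m := m)
  have hbdd : BddAbove (Set.range fun P : LOCC (Fin (m + 1)) (GLabel m × Bool) (GhzSpace m) =>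
      ∑ x, p x * P.prob (jointState (d := fun _ : Fin (m + 1) => 2) (gState m x) id
        (pureState (ghz (m + 1)))) x) := by
    refine ⟨1, ?_⟩
    rintro _ ⟨Q, rfl⟩
    refine le_trans (Finset.sum_le_sum fun x _ => ?_) hp1.le
    rw [hjoint]
    exact mul_le_of_le_one_right (hp x).le ((Q.prob_le _ _).trans (hfrob x).le)
  refine le_trans (le_of_eq ?_) (le_ciSup hbdd P)
  simp only [hjoint, hP, hfrob, mul_one, hp1]

end Protocol

theorem corollary2 (m : ℕ) (hm : 1 ≤ m)
    (p : GLabel m × Bool → ℝ) (hp : ∀ x, 0 < p x) (hp1 : ∑ x, p x = 1)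
    (d : Fin m → ℕ) (ρ : Matrix (∀ s, Fin (d s)) (∀ s, Fin (d s)) ℂ) (hρ : IsDensity ρ)
    (own : Fin m → Fin (m + 1)) :
    payoff (d := fun _ : Fin (m + 1) => 2) p (gState m) id (pureState (ghz (m + 1))) >
      payoff p (gState m) own ρ := by
  -- Pigeonhole: `m` subsystems cannot cover `m + 1` parties.
  obtain ⟨j, hj⟩ : ∃ j, ∀ s, own s ≠ j := by
    by_contra! h
    have := Fintype.card_le_of_surjective own h
    simp at this
  exact (payoff_lt_one hm p hp hp1 own ρ hρ j hj).trans_le (one_le_payoff_ghz p hp hp1)
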